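/- Let $H$ be a real separable Hilbert space (for instance $H=L^2(\mathcal Z,\nu)$) and, for $v,w\in H$, let $v\otimes w$ be the operator $x\mapsto\langle v,x\rangle w$. Operators carry the operator norm. **Errors.** Let $(\varepsilon_i)_{i\in\mathbb Z}$ be a centered strictly stationary sequence of $H$-valued random variables with $E\|\varepsilon_1\|^{\kappa}<\infty$ for some $\kappa>2$. Put $C_r=E[\varepsilon_0\otimes\varepsilon_r]$ and assume $\sum_{r\in\mathbb Z}\|C_r\|<\infty$ and $C_\varepsilon:=\sum_{r\in\mathbb Z}C_r\neq0$. Let $C_\varepsilon=\sum_{p\ge1}\lambda_p\,v_p\otimes v_p$ be its spectral decomposition, with $\lambda_1\ge\lambda_2\ge\dots$ and $(v_p)_{p\ge1}$ orthonormal, and assume $\sum_{p\ge1}\sum_{r\in\mathbb Z}|\mathrm{Cov}(\langle\varepsilon_0,v_p\rangle,\langle\varepsilon_r,v_p\rangle)|<\infty$. Assume the functional central limit theorem: $\big(n^{-1/2}\sum_{i=1}^{\lfloor nt\rfloor}\varepsilon_i\big)_{t\in[0,1]}$ converges in distribution, in the Skorokhod space $D([0,1];H)$, to an $H$-valued Brownian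 motion with covariance operator $C_\varepsilon$. **Weight function.** Let $h:[-1,1]\to\mathbb R$ be non-constant, of bounded variation, with $h(x)=0$ for $x\le0$, and assume that there are $\alpha,\beta>0$ with $|h(t)-h(s)|\le\beta|s-t|^\alpha$ for all $s,t\in[0,1]$. **Observations and statistics.** Let $X_i=\mu_i+\varepsilon_i$ for $i\ge1$ with $\mu_i\in H$, and let $\bar X_n=\frac1n\sum_{i=1}^nX_i$. The null hypothesis $H_0$ is that all $\mu_i$ are equal. Put $$T_{n,\mathrm{FF}}(h)=\max_{1\le k<n}\Big\|\frac1{\sqrt n}\sum_{i=1}^nh\Big(\frac{i-k}n\Big)(X_i-\bar X_n)\Big\|,$$ $$T_{n,\mathrm{WF}}(h;\hat C_n)=\max_{1\le k<n}\Big\|(\hat C_n+\hat\lambda_1\mathrm{Id})^{-1/2}\frac1{\sqrt n}\sum_{i=1}^nh\Big(\frac{i-k}n\Big)(X_i-\bar X_n)\Big\|,$$ where $\hat C_n$ is a random bounded self-adjoint operator on $H$, $\hat\lambda_1$ is its largest eigenvalue, and $A^{-1/2}$ is the unique positive definite $R$ with $RAR=\mathrm{Id}$ (the probability that $\hat\lambda_1$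 or $(\hat C_n+\hat\lambda_1\mathrm{Id})^{-1/2}$ fails to exist tends to $0$ under the assumption of (b); the values assigned there are irrelevant). **Limit.** Let $B_1,B_2,\dots$ be i.i.d. standard Brownian bridges on $[0,1]$ and $$G_p(t)=\int_0^{1-t}B_p(1-t-y)\,dh(y),\qquad 0<t<1 .$$ **Theorem.** Assume $H_0$. (a) As $n\to\infty$, $$T_{n,\mathrm{FF}}(h)\ \xrightarrow{\ \mathcal D\ }\ \sup_{0<t<1}\Big(\sum_{p\ge1}\lambda_p\,G_p^2(t)\Big)^{1/2}.$$ (b) If in addition $\|\hat C_n-C_\varepsilon\|\to0$ in probability, then $$T_{n,\mathrm{WF}}(h;\hat C_n)\ \xrightarrow{\ \mathcal D\ }\ \sup_{0<t<1}\Big(\sum_{p\ge1}\frac{\lambda_p}{\lambda_1+\lambda_p}\,G_p^2(t)\Big)^{1/2}.$$ In both cases, almost surely, the series converges for every $t\in(0,1)$ and the supremum is finite. -/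

import Mathlib

open MeasureTheory ProbabilityTheory Filter Set
open scoped Topology ENNReal

/-! ### The Skorokhod space `D([0,1]; E)` -/

/-- Right-continuous paths `[0,1] → E` with left limits. -/
structure CadlagPath (E : Type*) [TopologicalSpace E] where
  toFun : unitInterval → E
  rightCont : ∀ t, ContinuousWithinAt toFun (Ici t) t
  leftLim : ∀ t, ∃ l, Tendsto toFun (𝓝[<] t) (𝓝 l)

namespace CadlagPath

instance {E : Type*} [TopologicalSpace E] : CoeFun (CadlagPath E) fun _ => unitInterval → E :=
  ⟨CadlagPath.toFun⟩

/-- Skorokhod's (J1) distance: the infimum over all increasing bijections `φ` of `[0,1]` of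
`max (sup_t |φ t - t|) (sup_t d(f (φ t), g t))`. -/
noncomputable instance {E : Type*} [PseudoEMetricSpace E] : PseudoEMetricSpace (CadlagPath E) where
  edist f g := ⨅ φ : unitInterval ≃o unitInterval,
    max (⨆ t, edist (φ t) t) (⨆ t, edist (f (φ t)) (g t))
  edist_self f := by
    refine le_antisymm (iInf_le_of_le (OrderIso.refl _) ?_) bot_le
    simp
  edist_comm f g := by
    have key : ∀ f g : CadlagPath E,
        (⨅ φ : unitInterval ≃o unitInterval,
          max (⨆ t, edist (φ t) t) (⨆ t, edist (f (φ t)) (g t))) ≤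
        ⨅ φ : unitInterval ≃o unitInterval,
          max (⨆ t, edist (φ t) t) (⨆ t, edist (g (φ t)) (f t)) := by
      intro f g
      refine le_iInf fun φ => iInf_le_of_le φ.symm (max_le_max ?_ ?_)
      · refine iSup_le fun t => le_iSup_of_le (φ.symm t) ?_
        rw [φ.apply_symm_apply, edist_comm]
      · refine iSup_le fun t => le_iSup_of_le (φ.symm t) ?_
        rw [φ.apply_symm_apply, edist_comm]
    exact le_antisymm (key f g) (key g f)
  edist_triangle f g h := by
    refine ENNReal.le_iInf_add_iInf fun φ ψ => iInf_le_of_le (ψ.trans φ) (max_le ?_ ?_)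
    · refine iSup_le fun t => (edist_triangle _ (ψ t) _).trans ?_
      exact add_le_add
        (le_max_of_le_left (le_iSup (fun s => edist (φ s) s) (ψ t)))
        (le_max_of_le_left (le_iSup (fun s => edist (ψ s) s) t))
    · refine iSup_le fun t => (edist_triangle _ (g (ψ t)) _).trans ?_
      exact add_le_add
        (le_max_of_le_right (le_iSup (fun s => edist (f (φ s)) (g s)) (ψ t)))
        (le_max_of_le_right (le_iSup (fun s => edist (g (ψ s)) (h s)) t))

noncomputable instance {E : Type*} [PseudoEMetricSpace E] : MeasurableSpace (CadlagPath E) := borel _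

instance {E : Type*} [PseudoEMetricSpace E] : BorelSpace (CadlagPath E) := ⟨rfl⟩

end CadlagPath

section Probability

variable {Ω : Type*} [MeasurableSpace Ω]
variable {H : Type*} [NormedAddCommGroup H] [InnerProductSpace ℝ H]

/-- The rescaled partial sum path `t ↦ n^{-1/2} ∑_{i=1}^{⌊nt⌋} e_i` as an element of
`D([0,1]; H)`. -/
noncomputable def partialSumPath (e : ℤ → H) (n : ℕ) : CadlagPath H where
  toFun t := (√(n : ℝ))⁻¹ • ∑ i ∈ Finset.Icc (1 : ℤ) ⌊(n : ℝ) * t⌋, e i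
  rightCont t := by
    have h1 : Tendsto (fun s : unitInterval => (n : ℝ) * s) (𝓝[≥] t) (𝓝[≥] ((n : ℝ) * t)) := by
      refine tendsto_nhdsWithin_iff.2 ⟨?_, ?_⟩
      · exact (Continuous.tendsto (by fun_prop) t).mono_left nhdsWithin_le_nhds
      · filter_upwards [self_mem_nhdsWithin] with s hs
        exact mul_le_mul_of_nonneg_left ((show (t : ℝ) ≤ s from hs)) (Nat.cast_nonneg n)
    have h2 := (tendsto_floor_right_pure_floor ((n : ℝ) * t)).comp h1
    refine tendsto_nhds_of_eventually_eq ?_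
    filter_upwards [tendsto_pure.1 h2] with s hs
    simp only [Function.comp_apply] at hs
    rw [hs]
  leftLim t := by
    rcases Nat.eq_zero_or_pos n with rfl | hn
    · exact ⟨0, by simpa using tendsto_const_nhds⟩
    have h1 : Tendsto (fun s : unitInterval => (n : ℝ) * s) (𝓝[<] t) (𝓝[<] ((n : ℝ) * t)) := by
      refine tendsto_nhdsWithin_iff.2 ⟨?_, ?_⟩
      · exact (Continuous.tendsto (by fun_prop) t).mono_left nhdsWithin_le_nhds
      · filter_upwards [self_mem_nhdsWithin] with s hs
        exact mul_lt_mul_of_pos_left ((show (s : ℝ) < t from hs)) (Nat.cast_pos.2 hn)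
    have h2 := (tendsto_floor_left_pure_ceil_sub_one ((n : ℝ) * t)).comp h1
    refine ⟨_, tendsto_nhds_of_eventually_eq
      (x := (√(n : ℝ))⁻¹ • ∑ i ∈ Finset.Icc (1 : ℤ) (⌈(n : ℝ) * t⌉ - 1), e i) ?_⟩
    filter_upwards [tendsto_pure.1 h2] with s hs
    simp only [Function.comp_apply] at hs
    rw [hs]

/-- `W` is an `H`-valued Brownian motion on `[0,1]` with covariance operator `C`: it starts at `0`,
has continuous paths and independent increments, and `W t - W s` is a centered Gaussian element of
`H` with covariance operator `(t - s) C`. -/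
structure IsHilbertBrownianMotion [MeasurableSpace H] (C : H →L[ℝ] H) (W : Ω → CadlagPath H)
    (P : Measure Ω) : Prop where
  aemeasurable : ∀ t, AEMeasurable (fun ω => W ω t) P
  zero : ∀ᵐ ω ∂P, W ω 0 = 0
  cont : ∀ᵐ ω ∂P, Continuous (W ω)
  indep : HasIndepIncrements (fun t ω => W ω t) P
  gaussian : ∀ s t : unitInterval, s ≤ t → ∀ x : H,
    HasLaw (fun ω => inner ℝ x (W ω t - W ω s))
      (gaussianReal 0 (((t : ℝ) - s) * inner ℝ x (C x)).toNNReal) P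

/-- Standard Brownian bridge on `[0,1]`. -/
structure IsBrownianBridge (B : unitInterval → Ω → ℝ) (P : Measure Ω) : Prop where
  gaussian : IsGaussianProcess B P
  centered : ∀ t, ∫ ω, B t ω ∂P = 0
  cov : ∀ s t : unitInterval, cov[B s, B t; P] = min (s : ℝ) t - s * t
  cont : ∀ᵐ ω ∂P, Continuous fun t => B t ω

/-! ### The error sequence -/

/-- The lag-`r` covariance operator `C_r = E[ε_0 ⊗ ε_r]`, where `(v ⊗ w) x = ⟨v, x⟩ w`. -/
noncomputable def lagCov (ε : ℤ → Ω → H) (P : Measure Ω) (r : ℤ) : H →L[ℝ] H :=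
  ∫ ω, InnerProductSpace.rankOne ℝ (ε r ω) (ε 0 ω) ∂P

/-- The long-run covariance operator `∑_{r ∈ ℤ} C_r`. -/
noncomputable def longRunCov (ε : ℤ → Ω → H) (P : Measure Ω) : H →L[ℝ] H :=
  ∑' r : ℤ, lagCov ε P r

/-- The assumptions on the errors: a centered strictly stationary sequence with a moment of order
`κ > 2`, absolutely summable lag covariances and nonzero long-run covariance operator, whose
spectral decomposition is `∑_p lam_p v_p ⊗ v_p`, with absolutely summable autocovariances of the
scores. -/
structure ErrorAssumption [MeasurableSpace H] (ε : ℤ → Ω → H) (P : Measure Ω)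
    (lam : ℕ → ℝ) (v : ℕ → H) : Prop where
  measurable : ∀ i, Measurable (ε i)
  stationary : ∀ k : ℤ, P.map (fun ω i => ε (i + k) ω) = P.map (fun ω i => ε i ω)
  moment : ∃ κ : ℝ, 2 < κ ∧ Integrable (fun ω => ‖ε 1 ω‖ ^ κ) P
  centered : ∀ i, ∫ ω, ε i ω ∂P = 0
  summable_lagCov : Summable fun r : ℤ => ‖lagCov ε P r‖
  longRunCov_ne_zero : longRunCov ε P ≠ 0
  antitone : Antitone lam
  orthonormal : Orthonormal ℝ v
  spectral : HasSum (fun p => lam p • InnerProductSpace.rankOne ℝ (v p) (v p)) (longRunCov ε P)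
  summable_cov : Summable fun q : ℕ × ℤ =>
    |cov[fun ω => inner ℝ (ε 0 ω) (v q.1), fun ω => inner ℝ (ε q.2 ω) (v q.1); P]|

end Probability

/-! ### The weight function -/

/-- The assumption on the weight function `h : [-1,1] → ℝ` (values outside `[-1,1]` are never
used). -/
structure IsChangeWeight (h : ℝ → ℝ) : Prop where
  nonconstant : ∃ x ∈ Icc (-1 : ℝ) 1, ∃ y ∈ Icc (-1 : ℝ) 1, h x ≠ h y
  zero : ∀ x ∈ Icc (-1 : ℝ) 0, h x = 0
  boundedVariation : BoundedVariationOn h (Icc (-1) 1)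
  holder : ∃ α > 0, ∃ β > 0, ∀ s ∈ Icc (0 : ℝ) 1, ∀ t ∈ Icc (0 : ℝ) 1,
    |h t - h s| ≤ β * |s - t| ^ (α : ℝ)

/-- The constant extension of `h : [-1,1] → ℝ` to the real line. -/
noncomputable def clampExtend (h : ℝ → ℝ) (x : ℝ) : ℝ := h (max (-1) (min 1 x))

theorem clampExtend_boundedVariation {h : ℝ → ℝ} (hh : BoundedVariationOn h (Icc (-1) 1)) :
    BoundedVariationOn (clampExtend h) univ := by
  have hle : eVariationOn (h ∘ fun x => max (-1) (min 1 x)) univ ≤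
      eVariationOn h (Icc (-1) 1) := by
    refine eVariationOn.comp_le_of_monotoneOn h _ ?_ ?_
    · intro x _ y _ hxy
      exact max_le_max le_rfl (min_le_min le_rfl hxy)
    · intro x _
      exact ⟨le_max_left _ _, max_le (by norm_num) (min_le_left _ _)⟩
  exact ne_top_of_le_ne_top hh hle

/-- `∫_0^{1-t} b(1-t-y) dh(y)`, the Stieltjes integral of a path `b : [0,1] → ℝ` with respect to
the signed measure `dh` of the function `h` of bounded variation on `[-1,1]`. -/
noncomputable def gradualIntegral {h : ℝ → ℝ} (hh : BoundedVariationOn h (Icc (-1) 1))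
    (b : unitInterval → ℝ) (t : ℝ) : ℝ :=
  ∫ᵛ y in Ioc 0 (1 - t), IccExtend zero_le_one b (1 - t - y)
    ∂•(clampExtend_boundedVariation hh).vectorMeasure

/-- The functional `sup_{0<t<1} (∑_p w_p g_p(t)²)^{1/2}`. -/
noncomputable def supWeighted (w : ℕ → ℝ) (g : ℕ → ℝ → ℝ) : ℝ :=
  ⨆ t : Ioo (0 : ℝ) 1, √(∑' p, w p * g p t ^ 2)

/-- The series in `supWeighted` converges for every `t` and the supremum is finite. -/
def SupWeightedFinite (w : ℕ → ℝ) (g : ℕ → ℝ → ℝ) : Prop :=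
  (∀ t ∈ Ioo (0 : ℝ) 1, Summable fun p => w p * g p t ^ 2) ∧
    BddAbove (range fun t : Ioo (0 : ℝ) 1 => √(∑' p, w p * g p t ^ 2))

/-! ### The test statistics -/

section Statistics

variable {H : Type*} [NormedAddCommGroup H] [InnerProductSpace ℝ H]

/-- The sample mean of `x_1, …, x_n`. -/
noncomputable def sampleMean (n : ℕ) (x : ℕ → H) : H :=
  (n : ℝ)⁻¹ • ∑ i ∈ Finset.Icc 1 n, x i

/-- `n^{-1/2} ∑_{i=1}^n h((i-k)/n) (x_i - x̄_n)`. -/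
noncomputable def weightedSum (h : ℝ → ℝ) (n k : ℕ) (x : ℕ → H) : H :=
  (√(n : ℝ))⁻¹ • ∑ i ∈ Finset.Icc 1 n, h (((i : ℝ) - k) / n) • (x i - sampleMean n x)

/-- The fully functional statistic `T_{n,FF}(h)`; the maximum is over `1 ≤ k < n`. -/
noncomputable def statFF (h : ℝ → ℝ) (n : ℕ) (x : ℕ → H) : ℝ :=
  ⨆ k : Finset.Ico 1 n, ‖weightedSum h n k x‖

/-- The largest eigenvalue of a bounded operator. -/
noncomputable def topEigenvalue (A : H →L[ℝ] H) : ℝ :=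
  sSup {r : ℝ | Module.End.HasEigenvalue (A : H →ₗ[ℝ] H) r}

/-- `R` is positive definite and `R A R = Id`. -/
def IsInvSqrt [CompleteSpace H] (A R : H →L[ℝ] H) : Prop :=
  IsSelfAdjoint R ∧ (∀ x, x ≠ 0 → 0 < inner ℝ (R x) x) ∧
    R ∘L A ∘L R = ContinuousLinearMap.id ℝ H

open Classical in
/-- `A^{-1/2}`, the unique positive definite `R` with `R A R = Id` (and `0` if there is none). -/
noncomputable def invSqrt [CompleteSpace H] (A : H →L[ℝ] H) : H →L[ℝ] H :=
  if hA : ∃ R, IsInvSqrt A R then hA.choose else 0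

/-- The weighted functional statistic `T_{n,WF}(h; A)`, for an estimate `A` of the long-run
covariance operator. -/
noncomputable def statWF [CompleteSpace H] (h : ℝ → ℝ) (n : ℕ) (A : H →L[ℝ] H) (x : ℕ → H) : ℝ :=
  ⨆ k : Finset.Ico 1 n,
    ‖invSqrt (A + topEigenvalue A • ContinuousLinearMap.id ℝ H) (weightedSum h n k x)‖

end Statistics

/-! Under the null hypothesis the residuals are those of the errors. Since `h` vanishes on `[-1,0]`
and the residuals sum to zero, summation by parts turns the weighted sum at `k` into minus a
Riemann–Stieltjes sum, with mesh `1/n`, of `y ↦ b (k/n + y)` against `dh`, where `b` is the bridge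
of the partial sum path (`weightedSum_eq`). Each statistic with a deterministic operator `R` is thus
a functional of that path alone.

Skorokhod convergence to a continuous path is uniform, and `h` has bounded variation, so these
functionals converge to `sup_t ‖R ∫ b(t+y) dh(y)‖` jointly in `n` and the path (`tendsto_maxStat`).
The functional central limit theorem and an extended continuous mapping theorem give the limit in
terms of the Hilbert space Brownian motion `W`.

To identify it, note that `W` stays in the closed span of the `v p`, where `‖R x‖²` is a weighted
sum of squared scores. The scores of the time-reversed bridge of `W` are jointly Gaussian with the
covariances of independent bridges `√λ_p B_p`. The limit is a measurable function of the scores at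
rational times (`rationalSup`), so equality of laws on a countable product suffices. It also carries
almost sure finiteness from `W` to the `B_p`.

Part (a) is `R = Id`. For (b), `R = (C_ε + λ₁ Id)^{-1/2}` is treated in the same way, and then `C_ε`
is replaced by its estimate. Because `‖R w‖² = ⟨(C_ε + λ₁ Id)⁻¹ w, w⟩`, an operator error `δ`
changes the statistic by at most a multiple of `√δ` times the statistic of (a), which is tight. The
largest eigenvalue of the estimate is controlled because a small self-adjoint perturbation of a
compact operator still attains the supremum of its quadratic form. -/

/-! ### Stieltjes integrals of continuous functions -/

section Stieltjes

instance SignedMeasure.isFiniteMeasure_variation {X : Type*} [MeasurableSpace X]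
    (μ : SignedMeasure X) : IsFiniteMeasure (VectorMeasure.variation μ) := by
  rw [← SignedMeasure.totalVariation_eq_variation]
  infer_instance

variable {E : Type*} [NormedAddCommGroup E]

theorem Continuous.vectorMeasure_integrableOn_Ioc (μ : SignedMeasure ℝ) {g : ℝ → E}
    (hg : Continuous g) (a b : ℝ) : (μ.restrict (Ioc a b)).Integrable g := by
  rw [VectorMeasure.Integrable, VectorMeasure.variation_restrict measurableSet_Ioc]
  exact hg.integrableOn_Ioc

variable [NormedSpace ℝ E]

theorem norm_setIntegral_sub_le (μ : SignedMeasure ℝ) {f g : ℝ → E}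
    (hf : (μ.restrict (Ioc 0 1)).Integrable f) (hg : (μ.restrict (Ioc 0 1)).Integrable g) {δ : ℝ}
    (hfg : ∀ y ∈ Ioc (0 : ℝ) 1, ‖f y - g y‖ ≤ δ) :
    ‖(∫ᵛ y in Ioc 0 1, f y ∂<•μ) - ∫ᵛ y in Ioc 0 1, g y ∂<•μ‖ ≤
      δ * (VectorMeasure.variation μ).real univ := by
  rw [← VectorMeasure.integral_fun_sub hf hg]
  have hδ : 0 ≤ δ := (norm_nonneg _).trans (hfg 1 (by simp))
  have h1 : ∀ᵐ y ∂(μ.restrict (Ioc 0 1)).variation, ‖f y - g y‖ ≤ δ := by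
    rw [VectorMeasure.variation_restrict measurableSet_Ioc]
    filter_upwards [ae_restrict_mem measurableSet_Ioc] with y hy using hfg y hy
  refine (VectorMeasure.norm_integral_le_of_norm_le_const h1).trans ?_
  have h2 : ‖(ContinuousLinearMap.lsmul ℝ ℝ : ℝ →L[ℝ] E →L[ℝ] E).flip‖ ≤ 1 := by
    rw [ContinuousLinearMap.opNorm_flip]
    exact ContinuousLinearMap.opNorm_lsmul_le
  have h3 : (μ.restrict (Ioc 0 1)).variation.real univ ≤
      (VectorMeasure.variation μ).real univ := by
    rw [VectorMeasure.variation_restrict measurableSet_Ioc]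
    simp only [measureReal_restrict_apply MeasurableSet.univ]
    exact measureReal_mono (subset_univ _)
  calc _ ≤ δ * 1 * (VectorMeasure.variation μ).real univ := by gcongr
    _ = _ := by ring

/-- The left-endpoint Riemann–Stieltjes sum over `(0, 1]` with mesh `1 / n`. -/
noncomputable def stieltjesSum (h : ℝ → ℝ) (g : ℝ → E) (n : ℕ) : E :=
  ∑ j ∈ Finset.range n, (h ((j + 1 : ℝ) / n) - h ((j : ℝ) / n)) • g ((j : ℝ) / n)

variable [CompleteSpace E]

theorem setIntegral_indicator_const (μ : SignedMeasure ℝ) {a b : ℝ} (ha : 0 ≤ a) (hb : b ≤ 1)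
    (c : E) :
    ∫ᵛ y in Ioc 0 1, (Ioc a b).indicator (fun _ => c) y ∂<•μ = μ (Ioc a b) • c := by
  rw [VectorMeasure.setIntegral_indicator measurableSet_Ioc measurableSet_Ioc,
    VectorMeasure.integral_const,
    VectorMeasure.restrict_apply _ (measurableSet_Ioc.inter measurableSet_Ioc) MeasurableSet.univ,
    univ_inter, inter_eq_right.2 (Ioc_subset_Ioc ha hb)]
  rfl

/-- The sum is itself an integral, that of the step function equal to `g (j/n)` on `(j/n, (j+1)/n]`,
so it suffices to compare integrands uniformly. -/
theorem norm_setIntegral_sub_stieltjesSum_le (μ : SignedMeasure ℝ) {h : ℝ → ℝ}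
    (hμ : ∀ a b, 0 ≤ a → a ≤ b → b ≤ 1 → μ (Ioc a b) = h b - h a) {g : ℝ → E} (hg : Continuous g)
    {n : ℕ} (hn : 0 < n) {δ : ℝ}
    (hδ : ∀ x y : ℝ, |x - y| ≤ 1 / n → ‖g x - g y‖ ≤ δ) :
    ‖(∫ᵛ y in Ioc 0 1, g y ∂<•μ) - stieltjesSum h g n‖ ≤
      δ * (VectorMeasure.variation μ).real univ := by
  have hn' : (0 : ℝ) < n := Nat.cast_pos.2 hn
  set s : ℕ → ℝ → E := fun j =>
    (Ioc ((j : ℝ) / n) ((j + 1 : ℝ) / n)).indicator (fun _ => g ((j : ℝ) / n)) with hs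
  have hle : ∀ j : ℕ, (j : ℝ) / n ≤ (j + 1 : ℝ) / n := fun j => by gcongr; linarith
  have hint : ∀ j ∈ Finset.range n, (μ.restrict (Ioc 0 1)).Integrable (s j) := fun j _ =>
    (integrable_const _).indicator measurableSet_Ioc
  have hsum : stieltjesSum h g n = ∫ᵛ y in Ioc 0 1, ∑ j ∈ Finset.range n, s j y ∂<•μ := by
    rw [VectorMeasure.integral_finsetSum _ hint]
    refine Finset.sum_congr rfl fun j hj => ?_
    have hj1 : (j + 1 : ℝ) / n ≤ 1 := by
      rw [div_le_one hn']
      exact_mod_cast Finset.mem_range.1 hj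
    rw [hs, setIntegral_indicator_const μ (by positivity) hj1, hμ _ _ (by positivity) (hle j) hj1]
  rw [hsum]
  refine norm_setIntegral_sub_le μ (hg.vectorMeasure_integrableOn_Ioc μ 0 1)
    (VectorMeasure.Integrable.fun_finsetSum _ hint) fun y hy => ?_
  have hpos : 0 < (n : ℝ) * y := mul_pos hn' hy.1
  -- The cells are open on the left, so the cell of `y` has index `⌈n y⌉ - 1`.
  obtain ⟨i, hi⟩ : ∃ i : ℕ, ⌈(n : ℝ) * y⌉₊ = i + 1 :=
    Nat.exists_eq_succ_of_ne_zero (Nat.ceil_pos.2 hpos).ne'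
  have hi1 : (i : ℝ) < n * y := by
    have := Nat.lt_ceil.1 (show i < ⌈(n : ℝ) * y⌉₊ by omega)
    exact this
  have hi2 : (n : ℝ) * y ≤ i + 1 := by
    have := Nat.le_ceil ((n : ℝ) * y)
    rw [hi] at this
    exact_mod_cast this
  have hin : i < n := by
    have : (i : ℝ) < n := hi1.trans_le (by nlinarith [hy.2])
    exact_mod_cast this
  have hmem : y ∈ Ioc ((i : ℝ) / n) ((i + 1 : ℝ) / n) :=
    ⟨by rw [div_lt_iff₀ hn']; linarith, by rw [le_div_iff₀ hn']; linarith⟩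
  have hsy : ∑ j ∈ Finset.range n, s j y = g ((i : ℝ) / n) := by
    rw [Finset.sum_eq_single i]
    · simp only [hs]
      rw [indicator_of_mem hmem]
    · intro j _ hji
      simp only [hs]
      refine indicator_of_notMem (fun hj => hji ?_) _
      have a1 : (j : ℝ) < n * y := by have := (div_lt_iff₀ hn').1 hj.1; linarith
      have a2 : (n : ℝ) * y ≤ j + 1 := by have := (le_div_iff₀ hn').1 hj.2; linarith
      have b1 : j < i + 1 := by exact_mod_cast a1.trans_le hi2
      have b2 : i < j + 1 := by exact_mod_cast hi1.trans_le a2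
      omega
    · intro hi'
      exact absurd (Finset.mem_range.2 hin) hi'
  rw [hsy]
  refine hδ _ _ ?_
  rw [abs_of_nonneg (by linarith [hmem.1])]
  have := hmem.2
  rw [add_div] at this
  linarith

theorem tendsto_stieltjesSum (μ : SignedMeasure ℝ) {h : ℝ → ℝ}
    (hμ : ∀ a b, 0 ≤ a → a ≤ b → b ≤ 1 → μ (Ioc a b) = h b - h a) {g : ℝ → E}
    (hg : UniformContinuous g) :
    Tendsto (stieltjesSum h g) atTop (𝓝 (∫ᵛ y in Ioc 0 1, g y ∂<•μ)) := by
  rw [Metric.tendsto_atTop]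
  intro e he
  set V := (VectorMeasure.variation μ).real univ
  have hV : 0 ≤ V := measureReal_nonneg
  -- The `+ 1` covers a measure of zero variation.
  obtain ⟨η, hη, hgη⟩ := Metric.uniformContinuous_iff.1 hg (e / (V + 1)) (by positivity)
  obtain ⟨N, hN⟩ := exists_nat_one_div_lt hη
  refine ⟨N + 1, fun n hn => ?_⟩
  have hn0 : 0 < n := by omega
  have h1 : (1 : ℝ) / n < η := by
    refine lt_of_le_of_lt ?_ hN
    gcongr
    exact_mod_cast hn
  rw [dist_comm, dist_eq_norm]
  refine (norm_setIntegral_sub_stieltjesSum_le μ hμ hg.continuous hn0 (δ := e / (V + 1))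
    fun x y hxy => ?_).trans_lt ?_
  · rw [← dist_eq_norm]
    exact (hgη (by rw [Real.dist_eq]; linarith)).le
  · rw [div_mul_eq_mul_div, div_lt_iff₀ (by positivity)]
    nlinarith

/-- Both sides are limits of Riemann–Stieltjes sums, with which `L` commutes. -/
theorem ContinuousLinearMap.map_setIntegral_signedMeasure {F : Type*} [NormedAddCommGroup F]
    [NormedSpace ℝ F] [CompleteSpace F] (L : E →L[ℝ] F) (μ : SignedMeasure ℝ) {h : ℝ → ℝ}
    (hμ : ∀ a b, 0 ≤ a → a ≤ b → b ≤ 1 → μ (Ioc a b) = h b - h a) {g : ℝ → E}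
    (hg : UniformContinuous g) :
    L (∫ᵛ y in Ioc 0 1, g y ∂<•μ) = ∫ᵛ y in Ioc 0 1, L (g y) ∂<•μ := by
  have h1 := (L.continuous.tendsto _).comp (tendsto_stieltjesSum μ hμ hg)
  have h2 := tendsto_stieltjesSum μ hμ (L.uniformContinuous.comp hg)
  refine tendsto_nhds_unique h1 (h2.congr fun n => ?_)
  simp [stieltjesSum, map_sum]

end Stieltjes

/-! ### The weight function -/

section Weight

variable {h : ℝ → ℝ}

/-- The Hölder condition gives continuity on `[0,1]` only; as `h` is zero on `[-1,0]`, extending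
from `[0,1]` by constants gives the same function. -/
theorem IsChangeWeight.continuous_clampExtend (hh : IsChangeWeight h) :
    Continuous (clampExtend h) := by
  obtain ⟨α, hα, β, hβ, hol⟩ := hh.holder
  have h1 : ContinuousOn h (Icc 0 1) := by
    intro s hs
    rw [ContinuousWithinAt, tendsto_iff_norm_sub_tendsto_zero]
    have h2 : Tendsto (fun t => β * |s - t| ^ α) (𝓝[Icc 0 1] s) (𝓝 0) := by
      have : Continuous fun t => β * |s - t| ^ α :=
        continuous_const.mul ((by fun_prop : Continuous fun t => |s - t|).rpow_const
          fun _ => Or.inr hα.le)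
      have h3 := (this.tendsto s).mono_left (nhdsWithin_le_nhds (s := Icc 0 1))
      simpa [Real.zero_rpow hα.ne'] using h3
    refine squeeze_zero' (Eventually.of_forall fun _ => norm_nonneg _) ?_ h2
    filter_upwards [self_mem_nhdsWithin] with t ht
    exact hol s hs t ht
  have h2 := (continuousOn_iff_continuous_domRestrict.1 h1).Icc_extend' (h := zero_le_one)
  refine h2.congr fun x => ?_
  change h (max 0 (min 1 x)) = h (max (-1) (min 1 x))
  rcases le_total x 0 with hx | hx
  · rw [min_eq_right (hx.trans zero_le_one), max_eq_left hx, hh.zero 0 (by norm_num),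
      hh.zero _ ⟨le_max_left _ _, max_le (by norm_num) hx⟩]
  · have : 0 ≤ min 1 x := le_min zero_le_one hx
    rw [max_eq_right this, max_eq_right (by linarith)]

/-- The measure of `(a,b]` is a difference of right limits, which continuity turns into values. -/
theorem IsChangeWeight.vectorMeasure_Ioc (hh : IsChangeWeight h) {a b : ℝ} (ha : 0 ≤ a)
    (hab : a ≤ b) (hb : b ≤ 1) :
    (clampExtend_boundedVariation hh.boundedVariation).vectorMeasure (Ioc a b) = h b - h a := by
  have hc := hh.continuous_clampExtend
  have he : ∀ x, 0 ≤ x → x ≤ 1 → clampExtend h x = h x := fun x h0 h1 => by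
    rw [clampExtend, min_eq_right h1, max_eq_right (by linarith)]
  rw [BoundedVariationOn.vectorMeasure_Ioc _ hab, hc.continuousWithinAt.rightLim_eq,
    hc.continuousWithinAt.rightLim_eq, he _ ha (hab.trans hb), he _ (ha.trans hab) hb]

/-- The signed measure `dh`. -/
noncomputable def IsChangeWeight.signedMeasure (hh : IsChangeWeight h) : SignedMeasure ℝ :=
  (clampExtend_boundedVariation hh.boundedVariation).vectorMeasure

/-- A path on `[0,1]` with value `0` at `0` is integrated over the whole of `(0,1]`. -/
theorem gradualIntegral_eq (hh : IsChangeWeight h) {b : unitInterval → ℝ} (hb : b 0 = 0) {t : ℝ}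
    (ht : t ∈ Ioo (0 : ℝ) 1) :
    gradualIntegral hh.boundedVariation b t =
      ∫ᵛ y in Ioc 0 1, IccExtend zero_le_one b (1 - t - y) ∂<•hh.signedMeasure := by
  -- The two integrals pair scalar and integrand in opposite orders, which agree over `ℝ`.
  have hflip : (ContinuousLinearMap.lsmul ℝ ℝ : ℝ →L[ℝ] ℝ →L[ℝ] ℝ).flip =
      ContinuousLinearMap.lsmul ℝ ℝ := by
    ext
    simp
  rw [gradualIntegral, hflip]
  have h1 : Ioc (0 : ℝ) (1 - t) = Ioc 0 1 ∩ Ioc 0 (1 - t) :=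
    (inter_eq_right.2 (Ioc_subset_Ioc_right (by linarith [ht.1]))).symm
  rw [h1, ← VectorMeasure.setIntegral_indicator measurableSet_Ioc measurableSet_Ioc]
  refine VectorMeasure.setIntegral_congr_fun fun y hy => ?_
  by_cases hy1 : y ≤ 1 - t
  · exact indicator_of_mem (show y ∈ Ioc 0 (1 - t) from ⟨hy.1, hy1⟩) _
  -- Beyond `1 - t` the argument is negative, and the constant extension takes the value `b 0 = 0`
  -- there.
  · rw [indicator_of_notMem fun hy2 => hy1 hy2.2, IccExtend_of_le_left _ _ (by linarith)]
    exact hb.symm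

end Weight

/-! ### An extended continuous mapping theorem -/

section ContinuousMapping

/-- Extended continuous mapping theorem: if `S n → W` in distribution and `Φ n x → Z ω` as
`n → ∞` and `x → W ω`, for almost every `ω`, then `Φ n (S n) → Z` in distribution. -/
theorem tendstoInDistribution_of_tendsto_prod {D : Type*} [PseudoEMetricSpace D]
    [MeasurableSpace D] [BorelSpace D]
    {Ω Ω₁ : Type*} [MeasurableSpace Ω] [MeasurableSpace Ω₁] {P : Measure Ω}
    [IsProbabilityMeasure P] {P₁ : Measure Ω₁} [IsProbabilityMeasure P₁] {S : ℕ → Ω → D}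
    {W : Ω₁ → D} (hS : TendstoInDistribution S atTop W (fun _ => P) P₁) {Φ : ℕ → D → ℝ}
    {Z : Ω₁ → ℝ} (hΦ : ∀ᵐ ω ∂P₁,
      Tendsto (fun q : ℕ × D => Φ q.1 q.2) (atTop ×ˢ 𝓝 (W ω)) (𝓝 (Z ω)))
    (hmeas : ∀ n, AEMeasurable (fun ω => Φ n (S n ω)) P) (hZ : AEMeasurable Z P₁) :
    TendstoInDistribution (fun n ω => Φ n (S n ω)) atTop Z (fun _ => P) P₁ where
  forall_aemeasurable := hmeas
  aemeasurable_limit := hZ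
  tendsto := by
    refine tendsto_of_forall_isClosed_limsup_le' fun F hF => ?_
    simp only [ProbabilityMeasure.coe_mk]
    rw [Measure.map_apply_of_aemeasurable hZ hF.measurableSet]
    -- Closures make the portmanteau theorem applicable without any measurability of `Φ n`. A point
    -- lying in every `A m` is approached by points `x` with `Φ n x ∈ F` for arbitrarily large `n`.
    set A : ℕ → Set D := fun m => closure (⋃ n ≥ m, Φ n ⁻¹' F) with hA
    have hAanti : Antitone A := fun m m' hmm' =>
      closure_mono (biUnion_subset_biUnion_left fun n hn => le_trans hmm' hn)
    have hWm := hS.aemeasurable_limit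
    have key : ∀ m, limsup (fun n => (P.map fun ω => Φ n (S n ω)) F) atTop ≤ P₁ (W ⁻¹' A m) := by
      intro m
      have h1 := ProbabilityMeasure.limsup_measure_closed_le_of_tendsto hS.tendsto
        (isClosed_closure (s := ⋃ n ≥ m, Φ n ⁻¹' F))
      simp only [ProbabilityMeasure.coe_mk] at h1
      rw [Measure.map_apply_of_aemeasurable hWm isClosed_closure.measurableSet] at h1
      refine le_trans (limsup_le_limsup ?_) h1
      filter_upwards [eventually_ge_atTop m] with n hn
      rw [Measure.map_apply_of_aemeasurable (hmeas n) hF.measurableSet,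
        Measure.map_apply_of_aemeasurable (hS.forall_aemeasurable n) isClosed_closure.measurableSet]
      exact measure_mono fun ω hω => subset_closure (mem_iUnion₂.2 ⟨n, hn, hω⟩)
    have hlim : Tendsto (fun m => P₁ (W ⁻¹' A m)) atTop (𝓝 (P₁ (⋂ m, W ⁻¹' A m))) :=
      tendsto_measure_iInter_atTop
        (fun m => hWm.nullMeasurable isClosed_closure.measurableSet)
        (fun m m' hmm' => preimage_mono (hAanti hmm')) ⟨0, measure_ne_top _ _⟩
    refine (ge_of_tendsto' hlim key).trans (measure_mono_ae ?_)
    filter_upwards [hΦ] with ω hω hmem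
    change ω ∈ ⋂ m, W ⁻¹' A m at hmem
    change Z ω ∈ F
    have hfr : ∃ᶠ q in (atTop : Filter ℕ) ×ˢ 𝓝 (W ω), Φ q.1 q.2 ∈ F := by
      rw [(atTop_basis.prod (𝓝 (W ω)).basis_sets).frequently_iff]
      rintro ⟨m, U⟩ ⟨-, hU⟩
      have hm : W ω ∈ A m := mem_iInter.1 hmem m
      obtain ⟨x, hxU, hx⟩ := mem_closure_iff_nhds.1 hm U hU
      obtain ⟨n, hn, hxn⟩ := mem_iUnion₂.1 hx
      exact ⟨(n, x), ⟨hn, hxU⟩, hxn⟩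
    exact hF.mem_of_frequently_of_tendsto hfr hω

end ContinuousMapping

/-! ### The bridge of a path -/

section Bridge

variable {E : Type*} [NormedAddCommGroup E]

/-- The time change moves each instant by less than `η`, and uniform continuity of the limit path
absorbs this displacement. -/
theorem CadlagPath.eventually_forall_norm_sub_le {f : CadlagPath E} (hf : Continuous f) {e : ℝ}
    (he : 0 < e) : ∀ᶠ g : CadlagPath E in 𝓝 f, ∀ t, ‖g t - f t‖ ≤ e := by
  have hu := CompactSpace.uniformContinuous_of_continuous hf
  obtain ⟨η, hη, hfη⟩ := Metric.uniformContinuous_iff.1 hu (e / 2) (half_pos he)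
  have hpos : (0 : ℝ≥0∞) < ENNReal.ofReal (min η (e / 2)) :=
    ENNReal.ofReal_pos.2 (lt_min hη (half_pos he))
  filter_upwards [Metric.eball_mem_nhds f hpos] with g hg t
  have hg' : (⨅ φ : unitInterval ≃o unitInterval,
      max (⨆ t, edist (φ t) t) (⨆ t, edist (g (φ t)) (f t))) < ENNReal.ofReal (min η (e / 2)) := hg
  obtain ⟨φ, hφ⟩ := iInf_lt_iff.1 hg'
  obtain ⟨h1, h2⟩ := max_lt_iff.1 hφ
  set s := φ.symm t with hs
  have h3 : edist (φ s) s < ENNReal.ofReal (min η (e / 2)) :=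
    (le_iSup (fun t => edist (φ t) t) s).trans_lt h1
  have h4 : edist (g (φ s)) (f s) < ENNReal.ofReal (min η (e / 2)) :=
    (le_iSup (fun t => edist (g (φ t)) (f t)) s).trans_lt h2
  rw [hs, φ.apply_symm_apply, edist_dist, ENNReal.ofReal_lt_ofReal_iff_of_nonneg dist_nonneg,
    ← hs] at h3 h4
  have h5 := hfη (h3.trans_le (min_le_left _ _))
  have h6 := h4.trans_le (min_le_right _ _)
  rw [dist_comm] at h5
  rw [← dist_eq_norm]
  linarith [dist_triangle (g t) (f s) (f t)]

variable [NormedSpace ℝ E]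

/-- The bridge `s ↦ f s - s • f 1` of a path on `[0,1]`, extended by constants to the line. -/
noncomputable def bridgePath (f : unitInterval → E) (s : ℝ) : E :=
  f (projIcc 0 1 zero_le_one s) - (projIcc (0 : ℝ) 1 zero_le_one s : ℝ) • f 1

theorem bridgePath_of_one_le (f : unitInterval → E) {s : ℝ} (hs : 1 ≤ s) : bridgePath f s = 0 := by
  rw [bridgePath, projIcc_of_right_le _ hs]
  simp only [one_smul]
  exact sub_self _

theorem norm_bridgePath_sub_le {f g : unitInterval → E} {e : ℝ} (h : ∀ t, ‖g t - f t‖ ≤ e)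
    (s : ℝ) : ‖bridgePath g s - bridgePath f s‖ ≤ 2 * e := by
  have h1 : bridgePath g s - bridgePath f s =
      (g (projIcc 0 1 zero_le_one s) - f (projIcc 0 1 zero_le_one s)) -
        (projIcc (0 : ℝ) 1 zero_le_one s : ℝ) • (g 1 - f 1) := by
    simp only [bridgePath, smul_sub]
    abel
  have h2 : ‖(projIcc (0 : ℝ) 1 zero_le_one s : ℝ) • (g 1 - f 1)‖ ≤ 1 * e := by
    rw [norm_smul, Real.norm_of_nonneg (projIcc (0 : ℝ) 1 zero_le_one s).2.1]
    exact mul_le_mul (projIcc (0 : ℝ) 1 zero_le_one s).2.2 (h 1) (norm_nonneg _) zero_le_one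
  rw [h1]
  linarith [norm_sub_le (g (projIcc 0 1 zero_le_one s) - f (projIcc 0 1 zero_le_one s))
    ((projIcc (0 : ℝ) 1 zero_le_one s : ℝ) • (g 1 - f 1)), h (projIcc 0 1 zero_le_one s)]

theorem uniformContinuous_bridgePath {f : unitInterval → E} (hf : Continuous f) :
    UniformContinuous (bridgePath f) := by
  have h1 : UniformContinuous fun s : unitInterval => f s - (s : ℝ) • f 1 :=
    CompactSpace.uniformContinuous_of_continuous (by fun_prop)
  exact h1.comp (LipschitzWith.projIcc zero_le_one).uniformContinuous

theorem exists_norm_bridgePath_le {f : unitInterval → E} (hf : Continuous f) :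
    ∃ K, ∀ s, ‖bridgePath f s‖ ≤ K := by
  obtain ⟨K, hK⟩ := (isCompact_range (hf.norm)).bddAbove
  refine ⟨2 * K, fun s => ?_⟩
  have := norm_bridgePath_sub_le (f := fun _ => 0) (g := f) (e := K)
    (fun t => by simpa using hK ⟨t, rfl⟩) s
  simpa [bridgePath] using this

end Bridge

/-! ### The maximum of the Stieltjes sums -/

section MaxStat

variable {H : Type*} [NormedAddCommGroup H] [InnerProductSpace ℝ H] {h : ℝ → ℝ}

/-- The maximum over `1 ≤ k < n` of `‖R (∑ (h((j+1)/n) - h(j/n)) b((k+j)/n))‖`, where `b` is the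
bridge of the path. -/
noncomputable def maxStat (h : ℝ → ℝ) (R : H →L[ℝ] H) (n : ℕ) (f : CadlagPath H) : ℝ :=
  ⨆ k : Finset.Ico 1 n, ‖R (stieltjesSum h (fun y => bridgePath f (((k : ℕ) : ℝ) / n + y)) n)‖

theorem sum_abs_sub_le (hh : IsChangeWeight h) (n : ℕ) :
    ∑ j ∈ Finset.range n, |h ((j + 1 : ℝ) / n) - h ((j : ℝ) / n)| ≤
      (eVariationOn (clampExtend h) univ).toReal := by
  have he : ∀ x, 0 ≤ x → x ≤ 1 → clampExtend h x = h x := fun x h0 h1 => by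
    rw [clampExtend, min_eq_right h1, max_eq_right (by linarith)]
  have h1 := eVariationOn.sum_le (f := clampExtend h) (s := univ) (n := n)
    (u := fun j : ℕ => (j : ℝ) / n) (fun i j hij => by dsimp only; gcongr) (fun _ => mem_univ _)
  rw [← ENNReal.ofReal_le_iff_le_toReal (clampExtend_boundedVariation hh.boundedVariation),
    ENNReal.ofReal_sum_of_nonneg fun _ _ => abs_nonneg _]
  refine le_trans (le_of_eq (Finset.sum_congr rfl fun j hj => ?_)) h1
  have hn : (0 : ℝ) < n := by
    have := Finset.mem_range.1 hj
    exact_mod_cast (by omega : 0 < n)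
  have hj1 : (j + 1 : ℝ) ≤ n := by exact_mod_cast Finset.mem_range.1 hj
  rw [edist_dist, Real.dist_eq, Nat.cast_add, Nat.cast_one,
    he _ (by positivity) ((div_le_one hn).2 hj1),
    he _ (by positivity) ((div_le_one hn).2 (by linarith))]

theorem norm_stieltjesSum_sub_le (hh : IsChangeWeight h) {g g' : ℝ → H} {e : ℝ}
    (hg : ∀ y, ‖g y - g' y‖ ≤ e) (n : ℕ) :
    ‖stieltjesSum h g n - stieltjesSum h g' n‖ ≤
      (eVariationOn (clampExtend h) univ).toReal * e := by
  have he : 0 ≤ e := (norm_nonneg _).trans (hg 0)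
  rw [stieltjesSum, stieltjesSum, ← Finset.sum_sub_distrib]
  refine (norm_sum_le _ _).trans ?_
  refine le_trans ?_ (mul_le_mul_of_nonneg_right (sum_abs_sub_le hh n) he)
  rw [Finset.sum_mul]
  refine Finset.sum_le_sum fun j _ => ?_
  rw [← smul_sub, norm_smul, Real.norm_eq_abs]
  gcongr
  exact hg _

/-- `∫_0^1 b(t + y) dh(y)` for the bridge `b` of a path. -/
noncomputable def bridgeIntegral (hh : IsChangeWeight h) (f : unitInterval → H) (t : ℝ) : H :=
  ∫ᵛ y in Ioc 0 1, bridgePath f (t + y) ∂<•hh.signedMeasure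

theorem exists_norm_bridgeIntegral_le (hh : IsChangeWeight h) {f : unitInterval → H}
    (hf : Continuous f) : ∃ K, ∀ t, ‖bridgeIntegral hh f t‖ ≤ K := by
  obtain ⟨K, hK⟩ := exists_norm_bridgePath_le hf
  refine ⟨K * (VectorMeasure.variation hh.signedMeasure).real univ, fun t => ?_⟩
  have := norm_setIntegral_sub_le hh.signedMeasure (f := fun y => bridgePath f (t + y))
    (g := fun _ => 0) (δ := K)
    (((uniformContinuous_bridgePath hf).continuous.comp
      (continuous_const.add continuous_id)).vectorMeasure_integrableOn_Ioc _ _ _)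
    (continuous_const.vectorMeasure_integrableOn_Ioc _ _ _) (fun y _ => by simpa using hK _)
  simpa [bridgeIntegral] using this

variable [CompleteSpace H]

/-- The total variation of `h` and the modulus of continuity of the bridge do not depend on the
shift, so the sums approximate the integrals uniformly in `k`; the grid `k/n` is fine enough for the
maximum to approach the supremum. -/
theorem tendsto_maxStat (hh : IsChangeWeight h) (R : H →L[ℝ] H) {f : CadlagPath H}
    (hf : Continuous f) :
    Tendsto (fun q : ℕ × CadlagPath H => maxStat h R q.1 q.2) (atTop ×ˢ 𝓝 f)
      (𝓝 (⨆ t : Ioo (0 : ℝ) 1, ‖R (bridgeIntegral hh f t)‖)) := by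
  set u := bridgeIntegral hh f with hu
  set V := (eVariationOn (clampExtend h) univ).toReal
  set V' := (VectorMeasure.variation hh.signedMeasure).real univ
  have hV : 0 ≤ V := ENNReal.toReal_nonneg
  have hV' : 0 ≤ V' := measureReal_nonneg
  have hbc := uniformContinuous_bridgePath hf
  have hbt : ∀ t, Continuous fun y => bridgePath f (t + y) := fun t =>
    hbc.continuous.comp (by fun_prop)
  obtain ⟨K, hK⟩ := exists_norm_bridgeIntegral_le hh hf
  have hbdd : BddAbove (range fun t : Ioo (0 : ℝ) 1 => ‖R (u t)‖) := by
    refine ⟨‖R‖ * K, ?_⟩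
    rintro _ ⟨t, rfl⟩
    exact (R.le_opNorm _).trans (by gcongr; exact hK t)
  rw [Metric.tendsto_nhds]
  intro e he
  -- `2 V` pays for replacing the path (a bridge doubles the error), one `V'` for the Riemann sum
  -- and the other for moving `t` to the grid. The `+ 1` keeps `M` positive, and `M * d = e / 2`.
  set M := ‖R‖ * (2 * V + 2 * V') + 1 with hM
  have hM0 : 0 < M := by positivity
  set d := e / (2 * M) with hd
  have hd0 : 0 < d := by positivity
  obtain ⟨η, hη, hfη⟩ := Metric.uniformContinuous_iff.1 hbc d hd0
  obtain ⟨N, hN⟩ := exists_nat_one_div_lt hη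
  -- `N + 2` makes the mesh smaller than `η` and also forces `n ≥ 2`, so that some `k` with `1 ≤ k <
  -- n` exists.
  have hev := (eventually_ge_atTop (N + 2)).prod_mk
    (CadlagPath.eventually_forall_norm_sub_le hf hd0)
  filter_upwards [hev] with ⟨n, g⟩ ⟨hn, hg⟩
  dsimp only at hn hg ⊢
  have hn0 : 0 < n := by omega
  have hn' : (0 : ℝ) < n := by exact_mod_cast hn0
  have h1n : (1 : ℝ) / n < η := by
    refine lt_of_le_of_lt ?_ hN
    gcongr
    exact_mod_cast (by omega : N + 1 ≤ n)
  -- comparison of the sum with the integral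
  have hA : ∀ k : ℕ, ‖stieltjesSum h (fun y => bridgePath g ((k : ℝ) / n + y)) n - u (k / n)‖ ≤
      (2 * V + V') * d := by
    intro k
    have h1 := norm_stieltjesSum_sub_le hh (g := fun y => bridgePath g ((k : ℝ) / n + y))
      (g' := fun y => bridgePath f ((k : ℝ) / n + y))
      (fun y => norm_bridgePath_sub_le hg _) n
    have h2 := norm_setIntegral_sub_stieltjesSum_le hh.signedMeasure
      (fun a b ha hab hb => hh.vectorMeasure_Ioc ha hab hb) (hbt (k / n)) hn0 (δ := d)
      fun x y hxy => by
        rw [← dist_eq_norm]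
        refine (hfη ?_).le
        rw [Real.dist_eq]
        calc |(k : ℝ) / n + x - (k / n + y)| = |x - y| := by congr 1; ring
          _ < η := hxy.trans_lt h1n
    rw [norm_sub_rev] at h2
    change ‖stieltjesSum h (fun y => bridgePath f ((k : ℝ) / n + y)) n - u (k / n)‖ ≤ _ at h2
    have h3 := norm_sub_le_norm_sub_add_norm_sub
      (stieltjesSum h (fun y => bridgePath g ((k : ℝ) / n + y)) n)
      (stieltjesSum h (fun y => bridgePath f ((k : ℝ) / n + y)) n) (u (k / n))
    linarith
  have hB : ∀ s t : ℝ, |s - t| ≤ 1 / n → ‖u s - u t‖ ≤ d * V' := fun s t hst =>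
    norm_setIntegral_sub_le hh.signedMeasure ((hbt s).vectorMeasure_integrableOn_Ioc _ _ _)
      ((hbt t).vectorMeasure_integrableOn_Ioc _ _ _) fun y _ => by
        rw [← dist_eq_norm]
        refine (hfη ?_).le
        rw [Real.dist_eq]
        calc |s + y - (t + y)| = |s - t| := by congr 1; ring
          _ < η := hst.trans_lt h1n
  have hR : ∀ x y : H, ‖R x‖ ≤ ‖R y‖ + ‖R‖ * ‖x - y‖ := fun x y => by
    have h1 := R.le_opNorm (x - y)
    rw [map_sub] at h1
    linarith [norm_sub_norm_le (R x) (R y)]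
  have hMd : ‖R‖ * ((2 * V + 2 * V') * d) ≤ e / 2 := by
    have : M * d = e / 2 := by rw [hd]; field_simp
    nlinarith
  have hVd : 0 ≤ V' * d := by positivity
  have hne : Nonempty (Finset.Ico 1 n) := ⟨⟨1, Finset.mem_Ico.2 ⟨le_rfl, by omega⟩⟩⟩
  have hne' : Nonempty (Ioo (0 : ℝ) 1) := ⟨⟨1 / 2, by norm_num⟩⟩
  have hup : maxStat h R n g ≤ (⨆ t : Ioo (0 : ℝ) 1, ‖R (u t)‖) + e / 2 := by
    refine ciSup_le fun k => ?_
    obtain ⟨hk1, hk2⟩ := Finset.mem_Ico.1 k.2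
    have hk1' : (0 : ℝ) < (k : ℕ) := by exact_mod_cast hk1
    have hk2' : ((k : ℕ) : ℝ) < n := by exact_mod_cast hk2
    have h1 := le_ciSup hbdd ⟨((k : ℕ) : ℝ) / n, by positivity, by rwa [div_lt_one hn']⟩
    dsimp only at h1
    have h2 := mul_le_mul_of_nonneg_left (hA k) (norm_nonneg R)
    have h3 := mul_le_mul_of_nonneg_left
      (show (2 * V + V') * d ≤ (2 * V + 2 * V') * d by linarith) (norm_nonneg R)
    linarith [hR (stieltjesSum h (fun y => bridgePath g (((k : ℕ) : ℝ) / n + y)) n)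
      (u ((k : ℕ) / n))]
  have hlow : (⨆ t : Ioo (0 : ℝ) 1, ‖R (u t)‖) ≤ maxStat h R n g + e / 2 := by
    refine ciSup_le fun t => ?_
    obtain ⟨t, ht0, ht1⟩ := t
    dsimp only
    -- For `t < 1/n` the floor is `0`, which is not an admissible index; `1` is still within `1/n`
    -- of `t`.
    set k := max 1 ⌊t * n⌋₊ with hk
    have hfl := Nat.floor_le (show 0 ≤ t * n by positivity)
    have hfl2 := Nat.lt_floor_add_one (t * n)
    have hkn : k < n := by
      refine max_lt (by omega) ?_
      rw [Nat.floor_lt (by positivity)]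
      nlinarith
    have htk : |t - (k : ℝ) / n| ≤ 1 / n := by
      have : |t * n - k| ≤ 1 := by
        rcases Nat.eq_zero_or_pos ⌊t * n⌋₊ with h0 | h0
        · have hk' : (k : ℝ) = 1 := by rw [hk, h0]; norm_num
          rw [h0, Nat.cast_zero, zero_add] at hfl2
          have : 0 < t * n := by positivity
          rw [hk', abs_le]
          constructor <;> linarith
        · have hk' : k = ⌊t * n⌋₊ := max_eq_right h0
          rw [hk', abs_le]
          constructor <;> linarith
      have h2 : t - (k : ℝ) / n = (t * n - k) / n := by field_simp
      rw [h2, abs_div, abs_of_pos hn']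
      gcongr
    have h1 := le_ciSup (f := fun k : Finset.Ico 1 n =>
      ‖R (stieltjesSum h (fun y => bridgePath g (((k : ℕ) : ℝ) / n + y)) n)‖)
      (Set.finite_range _).bddAbove ⟨k, Finset.mem_Ico.2 ⟨le_max_left _ _, hkn⟩⟩
    dsimp only at h1
    change _ ≤ maxStat h R n g at h1
    have h2 := hA k
    rw [norm_sub_rev] at h2
    have h3 := mul_le_mul_of_nonneg_left h2 (norm_nonneg R)
    have h4 := mul_le_mul_of_nonneg_left (hB _ _ htk) (norm_nonneg R)
    linarith [hR (u t) (u (k / n)), hR (u (k / n))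
      (stieltjesSum h (fun y => bridgePath g ((k : ℝ) / n + y)) n)]
  rw [Real.dist_eq, abs_lt]
  constructor <;> linarith

end MaxStat

/-! ### The statistics as functionals of the partial sum path -/

section Abel

variable {H : Type*} [NormedAddCommGroup H] [InnerProductSpace ℝ H]

/-- Summation by parts; `a 0 = 0` removes the lower boundary term. -/
theorem sum_smul_sub_eq_neg_sum {E : Type*} [AddCommGroup E] [Module ℝ E] (a : ℕ → ℝ) (b : ℕ → E)
    (ha : a 0 = 0) (N : ℕ) :
    ∑ l ∈ Finset.range N, a (l + 1) • (b (l + 1) - b l) =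
      a N • b N - ∑ l ∈ Finset.range N, (a (l + 1) - a l) • b l := by
  induction N with
  | zero => simp [ha]
  | succ N ih =>
    rw [Finset.sum_range_succ, Finset.sum_range_succ, ih]
    module

theorem partialSumPath_natCast_div (e : ℤ → H) {n j : ℕ} (hn : 0 < n) (hj : j ≤ n) :
    partialSumPath e n (projIcc 0 1 zero_le_one ((j : ℝ) / n)) =
      (√(n : ℝ))⁻¹ • ∑ i ∈ Finset.Icc 1 j, e i := by
  have hn' : (0 : ℝ) < n := by exact_mod_cast hn
  have hmem : (j : ℝ) / n ∈ Icc (0 : ℝ) 1 :=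
    ⟨by positivity, (div_le_one hn').2 (by exact_mod_cast hj)⟩
  rw [projIcc_of_mem _ hmem]
  have hfl : ⌊(n : ℝ) * ((j : ℝ) / n)⌋ = (j : ℤ) := by
    rw [mul_div_cancel₀ _ hn'.ne', Int.floor_natCast]
  change (√(n : ℝ))⁻¹ • ∑ i ∈ Finset.Icc (1 : ℤ) ⌊(n : ℝ) * ((j : ℝ) / n)⌋, e i = _
  rw [hfl]
  congr 1
  refine (Finset.sum_bij (fun (i : ℕ) _ => (i : ℤ)) ?_ ?_ ?_ ?_).symm
  · intro i hi
    rw [Finset.mem_Icc] at hi ⊢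
    omega
  · intro i _ i' _ hii'
    exact_mod_cast hii'
  · intro i hi
    rw [Finset.mem_Icc] at hi
    exact ⟨i.toNat, by rw [Finset.mem_Icc]; omega, by omega⟩
  · intro i _
    rfl

theorem bridgePath_partialSumPath (e : ℤ → H) {n j : ℕ} (hn : 0 < n) (hj : j ≤ n) :
    bridgePath (partialSumPath e n) ((j : ℝ) / n) =
      (√(n : ℝ))⁻¹ • ∑ i ∈ Finset.Icc 1 j, (e i - sampleMean n fun i => e i) := by
  have hn' : (0 : ℝ) < n := by exact_mod_cast hn
  have h1 := partialSumPath_natCast_div e hn (le_refl n)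
  rw [div_self hn'.ne', projIcc_of_right_le _ le_rfl] at h1
  change partialSumPath e n 1 = _ at h1
  have hmem : (j : ℝ) / n ∈ Icc (0 : ℝ) 1 :=
    ⟨by positivity, (div_le_one hn').2 (by exact_mod_cast hj)⟩
  rw [bridgePath, partialSumPath_natCast_div e hn hj, h1, projIcc_of_mem _ hmem,
    Finset.sum_sub_distrib, Finset.sum_const, Nat.card_Icc, sampleMean, ← Nat.cast_smul_eq_nsmul ℝ]
  simp only [smul_sub, smul_smul, add_tsub_cancel_right]
  congr 2
  field_simp

/-- The common mean cancels from the residuals, and only indices `i > k` carry weight. Summation by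
parts against the partial sums of the residuals has no boundary terms, since `h 0 = 0` and all
residuals together sum to zero. -/
theorem weightedSum_eq {h : ℝ → ℝ} (hh : IsChangeWeight h) (e : ℤ → H) {m x : ℕ → H}
    (hx : ∀ i, 1 ≤ i → x i = m i + e i) (hm : ∀ i, 1 ≤ i → m i = m 1) {n k : ℕ}
    (hk : k ∈ Finset.Ico 1 n) :
    weightedSum h n k x =
      -stieltjesSum h (fun y => bridgePath (partialSumPath e n) ((k : ℝ) / n + y)) n := by
  obtain ⟨hk1, hkn⟩ := Finset.mem_Ico.1 hk
  have hn : 0 < n := by omega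
  have hn' : (0 : ℝ) < n := by exact_mod_cast hn
  set eb := sampleMean n fun i => e i with heb
  have hmean : sampleMean n x = m 1 + eb := by
    rw [heb, sampleMean, sampleMean, ← sub_eq_iff_eq_add', Finset.sum_congr rfl (g := fun i : ℕ =>
      m 1 + e i), Finset.sum_add_distrib, Finset.sum_const, Nat.card_Icc, smul_add,
      ← Nat.cast_smul_eq_nsmul ℝ, smul_smul]
    · simp only [add_tsub_cancel_right]
      rw [inv_mul_cancel₀ hn'.ne', one_smul]
      abel
    · intro i hi
      have := (Finset.mem_Icc.1 hi).1
      rw [hx i this, hm i this]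
  have hres : ∀ i ∈ Finset.Icc 1 n, x i - sampleMean n x = e i - eb := by
    intro i hi
    have := (Finset.mem_Icc.1 hi).1
    rw [hx i this, hm i this, hmean]
    abel
  obtain ⟨N, rfl⟩ : ∃ N, n = k + N := ⟨n - k, by omega⟩
  set n := k + N with hnN
  set B : ℕ → H := fun l => ∑ i ∈ Finset.Icc 1 (k + l), (e i - eb) with hB
  have hBs : ∀ l, B (l + 1) - B l = e ((k + l + 1 : ℕ) : ℤ) - eb := by
    intro l
    simp only [hB]
    rw [← add_assoc, Finset.sum_Icc_succ_top (by omega)]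
    abel
  have hBN : B N = 0 := by
    simp only [hB]
    rw [Finset.sum_sub_distrib, Finset.sum_const, Nat.card_Icc, heb, sampleMean,
      ← Nat.cast_smul_eq_nsmul ℝ, smul_smul]
    simp only [add_tsub_cancel_right]
    rw [mul_inv_cancel₀ (by exact_mod_cast hn.ne'), one_smul, sub_self]
  have h0 : h 0 = 0 := hh.zero 0 (by norm_num)
  have hleft : ∑ i ∈ Finset.Icc 1 n, h (((i : ℝ) - k) / n) • (e i - eb) =
      ∑ l ∈ Finset.range N, h (((l + 1 : ℕ) : ℝ) / n) • (B (l + 1) - B l) := by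
    have hsplit : Finset.Icc 1 n = Finset.Ico 1 (k + 1) ∪ Finset.Ico (k + 1) (n + 1) := by
      rw [Finset.Ico_union_Ico_eq_Ico (by omega) (by omega)]
      rfl
    rw [hsplit, Finset.sum_union (Finset.Ico_disjoint_Ico_consecutive _ _ _),
      Finset.sum_eq_zero, zero_add, Finset.sum_Ico_eq_sum_range]
    · have : n + 1 - (k + 1) = N := by omega
      rw [this]
      refine Finset.sum_congr rfl fun l _ => ?_
      rw [hBs, show k + 1 + l = k + l + 1 by ring]
      congr 3
      push_cast
      ring
    · intro i hi
      have hi' := Finset.mem_Ico.1 hi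
      have h1 : ((i : ℝ) - k) ≤ 0 := by
        have : (i : ℝ) ≤ k := by exact_mod_cast (by omega : i ≤ k)
        linarith
      have h2 : -(n : ℝ) ≤ (i : ℝ) - k := by
        have : (k : ℝ) ≤ n := by exact_mod_cast hkn.le
        have : (0 : ℝ) ≤ i := Nat.cast_nonneg _
        linarith
      rw [hh.zero _ ⟨by rw [le_div_iff₀ hn']; linarith,
        div_nonpos_of_nonpos_of_nonneg h1 hn'.le⟩, zero_smul]
  rw [weightedSum, Finset.sum_congr rfl fun i hi => by rw [hres i hi], hleft,
    sum_smul_sub_eq_neg_sum (fun l : ℕ => h ((l : ℝ) / n)) B (by simp [h0]), hBN, smul_zero,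
    zero_sub, smul_neg, stieltjesSum]
  congr 1
  -- Summation by parts yields only `N = n - k` terms; the further terms vanish because the bridge
  -- is zero from time `1` on.
  have hr : Finset.range n = Finset.range N ∪ Finset.Ico N n := by
    rw [Finset.range_eq_Ico, Finset.range_eq_Ico, Finset.Ico_union_Ico_eq_Ico (by omega) (by omega)]
  rw [hr, Finset.sum_union (by rw [Finset.range_eq_Ico]; exact
    Finset.Ico_disjoint_Ico_consecutive _ _ _), Finset.sum_eq_zero (s := Finset.Ico N n), add_zero,
    Finset.smul_sum]
  · refine Finset.sum_congr rfl fun l hl => ?_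
    have hl' := Finset.mem_range.1 hl
    have h1 : (k : ℝ) / n + (l : ℝ) / n = ((k + l : ℕ) : ℝ) / n := by push_cast; ring
    rw [h1, bridgePath_partialSumPath e hn (by omega), smul_comm]
    simp only [hB]
    push_cast
    rfl
  · intro l hl
    have hl' := Finset.mem_Ico.1 hl
    rw [bridgePath_of_one_le, smul_zero]
    rw [← add_div, le_div_iff₀ hn', one_mul]
    exact_mod_cast (by omega : n ≤ k + l)

theorem iSup_norm_weightedSum_eq {h : ℝ → ℝ} (hh : IsChangeWeight h) (R : H →L[ℝ] H) (e : ℤ → H)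
    {m x : ℕ → H} (hx : ∀ i, 1 ≤ i → x i = m i + e i) (hm : ∀ i, 1 ≤ i → m i = m 1) (n : ℕ) :
    ⨆ k : Finset.Ico 1 n, ‖R (weightedSum h n k x)‖ = maxStat h R n (partialSumPath e n) := by
  refine iSup_congr fun k => ?_
  rw [weightedSum_eq hh e hx hm k.2, map_neg, norm_neg]

theorem measurable_iSup_norm_weightedSum [MeasurableSpace H] [BorelSpace H]
    [SecondCountableTopology H] {Ω : Type*} [MeasurableSpace Ω] (h : ℝ → ℝ) (R : H →L[ℝ] H)
    {X : ℕ → Ω → H} (hX : ∀ i, 1 ≤ i → Measurable (X i)) (n : ℕ) :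
    Measurable fun ω => ⨆ k : Finset.Ico 1 n, ‖R (weightedSum h n k fun i => X i ω)‖ := by
  refine Measurable.iSup fun k => ((R.continuous.measurable.comp ?_).norm)
  have hmean : Measurable fun ω => sampleMean n fun i => X i ω :=
    (Finset.measurable_sum _ fun i hi => hX i (Finset.mem_Icc.1 hi).1).const_smul _
  exact (Finset.measurable_sum _ fun i hi =>
    ((hX i (Finset.mem_Icc.1 hi).1).sub hmean).const_smul _).const_smul _

end Abel

/-! ### The limit functional on countably many coordinates -/

section Functional

/-- `sup_t ∑_p w_p g_p(t)²` in `[0, ∞]`. -/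
noncomputable def esupWeighted (w : ℕ → ℝ) (g : ℕ → ℝ → ℝ) : ℝ≥0∞ :=
  ⨆ t : Ioo (0 : ℝ) 1, ∑' p, ENNReal.ofReal (w p * g p t ^ 2)

/-- In `[0,∞]` sums and suprema need no side conditions. Finiteness there gives the summability and
boundedness that make the real expressions meaningful. -/
theorem supWeighted_of_esupWeighted_ne_top {w : ℕ → ℝ} (hw : ∀ p, 0 ≤ w p) {g : ℕ → ℝ → ℝ}
    (hfin : esupWeighted w g ≠ ⊤) :
    SupWeightedFinite w g ∧ supWeighted w g = √(esupWeighted w g).toReal := by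
  have hnn : ∀ t p, 0 ≤ w p * g p t ^ 2 := fun t p => mul_nonneg (hw p) (sq_nonneg _)
  have hle : ∀ t : Ioo (0 : ℝ) 1, ∑' p, ENNReal.ofReal (w p * g p t ^ 2) ≤ esupWeighted w g :=
    fun t => le_iSup (fun t : Ioo (0 : ℝ) 1 => ∑' p, ENNReal.ofReal (w p * g p t ^ 2)) t
  have hsum : ∀ t : Ioo (0 : ℝ) 1, Summable fun p => w p * g p t ^ 2 := fun t => by
    have := ENNReal.summable_toReal (ne_top_of_le_ne_top hfin (hle t))
    simpa only [ENNReal.toReal_ofReal (hnn _ _)] using this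
  have htsum : ∀ t : Ioo (0 : ℝ) 1, ∑' p, ENNReal.ofReal (w p * g p t ^ 2) =
      ENNReal.ofReal (∑' p, w p * g p t ^ 2) := fun t =>
    (ENNReal.ofReal_tsum_of_nonneg (hnn t) (hsum t)).symm
  have hle' : ∀ t : Ioo (0 : ℝ) 1, √(∑' p, w p * g p t ^ 2) ≤ √(esupWeighted w g).toReal :=
    fun t => by
      refine Real.sqrt_le_sqrt ?_
      rw [← ENNReal.ofReal_le_iff_le_toReal hfin, ← htsum]
      exact hle t
  have hbdd : BddAbove (range fun t : Ioo (0 : ℝ) 1 => √(∑' p, w p * g p t ^ 2)) :=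
    ⟨_, forall_mem_range.2 hle'⟩
  have hne : Nonempty (Ioo (0 : ℝ) 1) := ⟨⟨1 / 2, by norm_num⟩⟩
  refine ⟨⟨fun t ht => hsum ⟨t, ht⟩, hbdd⟩, le_antisymm (ciSup_le hle') ?_⟩
  have hs0 : 0 ≤ supWeighted w g := Real.iSup_nonneg fun _ => Real.sqrt_nonneg _
  refine Real.sqrt_le_iff.2 ⟨hs0, ENNReal.toReal_le_of_le_ofReal (sq_nonneg _) ?_⟩
  refine iSup_le fun t => ?_
  rw [htsum]
  refine ENNReal.ofReal_le_ofReal ?_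
  rw [← Real.sqrt_le_left hs0]
  exact le_ciSup hbdd t

/-- The functional `esupWeighted` of the Stieltjes integrals of a family of paths, written in terms
of the values of the paths at rational times. -/
noncomputable def rationalSup (h : ℝ → ℝ) (c : ℕ → ℝ) (z : ℕ × ℚ → ℝ) : ℝ≥0∞ :=
  ⨆ t : {q : ℚ // 0 < q ∧ q < 1}, ∑' p, ENNReal.ofReal (c p) *
    limsup (fun n : ℕ => ENNReal.ofReal ((∑ j ∈ Finset.range n,
      (h ((j + 1 : ℝ) / n) - h ((j : ℝ) / n)) * z (p, 1 - t - (j : ℚ) / n)) ^ 2)) atTop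

/-- Only countable suprema, sums and limsups occur, and the limsup makes sense for every `z`, so an
equality of laws on `ℕ × ℚ → ℝ` can be pushed through. -/
theorem measurable_rationalSup (h : ℝ → ℝ) (c : ℕ → ℝ) : Measurable (rationalSup h c) := by
  refine Measurable.iSup fun t => Measurable.tsum fun p => Measurable.const_mul ?_ _
  refine Measurable.limsup fun n => ENNReal.measurable_ofReal.comp (Measurable.pow_const ?_ _)
  exact Finset.measurable_sum _ fun j _ => (measurable_pi_apply _).const_mul _

variable {h : ℝ → ℝ}

theorem uniformContinuous_reflect {b : unitInterval → ℝ} (hb : Continuous b) :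
    UniformContinuous (fun x : ℝ => IccExtend zero_le_one b x) :=
  (CompactSpace.uniformContinuous_of_continuous hb).comp
    (LipschitzWith.projIcc zero_le_one).uniformContinuous

/-- Needed to pass from rational `t` to all `t`. -/
theorem continuous_setIntegral_reflect (hh : IsChangeWeight h) {b : unitInterval → ℝ}
    (hb : Continuous b) : Continuous fun t : ℝ =>
      ∫ᵛ y in Ioc 0 1, IccExtend zero_le_one b (1 - t - y) ∂<•hh.signedMeasure := by
  have hu := uniformContinuous_reflect hb
  set V := (VectorMeasure.variation hh.signedMeasure).real univ
  have hV : 0 ≤ V := measureReal_nonneg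
  have hc : ∀ t, Continuous fun y => IccExtend zero_le_one b (1 - t - y) := fun t =>
    hu.continuous.comp (by fun_prop)
  refine Metric.continuous_iff.2 fun t e he => ?_
  obtain ⟨η, hη, hub⟩ := Metric.uniformContinuous_iff.1 hu (e / (V + 1)) (by positivity)
  refine ⟨η, hη, fun s hs => ?_⟩
  rw [dist_eq_norm]
  refine (norm_setIntegral_sub_le hh.signedMeasure ((hc s).vectorMeasure_integrableOn_Ioc _ _ _)
    ((hc t).vectorMeasure_integrableOn_Ioc _ _ _) (δ := e / (V + 1)) fun y _ => ?_).trans_lt ?_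
  · rw [← dist_eq_norm]
    refine (hub ?_).le
    rw [Real.dist_eq] at hs ⊢
    calc |1 - s - y - (1 - t - y)| = |s - t| := by rw [← abs_neg]; congr 1; ring
      _ < η := hs
  · rw [div_mul_eq_mul_div, div_lt_iff₀ (by positivity)]
    nlinarith

/-- For continuous paths the limsup is the limit of Riemann–Stieltjes sums, and density of the
rationals restores the full supremum. -/
theorem rationalSup_eq (hh : IsChangeWeight h) {c : ℕ → ℝ} (hc : ∀ p, 0 ≤ c p)
    {b : ℕ → unitInterval → ℝ} (hb : ∀ p, Continuous (b p)) (hb0 : ∀ p, b p 0 = 0) :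
    rationalSup h c (fun q => b q.1 (projIcc 0 1 zero_le_one (q.2 : ℝ))) =
      esupWeighted c fun p => gradualIntegral hh.boundedVariation (b p) := by
  set I : ℕ → ℝ → ℝ := fun p t =>
    ∫ᵛ y in Ioc 0 1, IccExtend zero_le_one (b p) (1 - t - y) ∂<•hh.signedMeasure with hI
  have hIc : ∀ p, Continuous (I p) := fun p => continuous_setIntegral_reflect hh (hb p)
  have h1 : rationalSup h c (fun q => b q.1 (projIcc 0 1 zero_le_one (q.2 : ℝ))) =
      ⨆ t : {q : ℚ // 0 < q ∧ q < 1}, ∑' p, ENNReal.ofReal (c p * I p t ^ 2) := by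
    refine iSup_congr fun t => tsum_congr fun p => ?_
    rw [ENNReal.ofReal_mul (hc p)]
    congr 1
    refine Tendsto.limsup_eq (ENNReal.tendsto_ofReal (Tendsto.pow ?_ 2))
    refine (tendsto_stieltjesSum hh.signedMeasure (fun a b ha hab hb =>
      hh.vectorMeasure_Ioc ha hab hb) ((uniformContinuous_reflect (hb p)).comp
      (uniformContinuous_const.sub uniformContinuous_id : UniformContinuous
        fun y : ℝ => 1 - ((t : ℚ) : ℝ) - y))).congr fun n => ?_
    refine Finset.sum_congr rfl fun j _ => ?_
    simp only [Function.comp_apply, smul_eq_mul, IccExtend_apply]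
    congr 2
    push_cast
    rfl
  have h2 : (esupWeighted c fun p => gradualIntegral hh.boundedVariation (b p)) =
      ⨆ t : Ioo (0 : ℝ) 1, ∑' p, ENNReal.ofReal (c p * I p t ^ 2) :=
    iSup_congr fun t => tsum_congr fun p => by
      dsimp only
      rw [gradualIntegral_eq hh (hb0 p) t.2]
  rw [h1, h2]
  refine le_antisymm (iSup_le fun t => ?_) (iSup_le fun t => ?_)
  · exact le_iSup (fun t : Ioo (0 : ℝ) 1 => ∑' p, ENNReal.ofReal (c p * I p t ^ 2))
      ⟨((t : ℚ) : ℝ), by exact_mod_cast t.2.1, by exact_mod_cast t.2.2⟩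
  -- Continuity in `t` of the infinite series is not available. Its finite partial sums are
  -- continuous, and a bound for them on the rationals extends to `(0,1)`.
  · rw [ENNReal.tsum_eq_iSup_sum]
    refine iSup_le fun s => ?_
    set S := ⨆ t : {q : ℚ // 0 < q ∧ q < 1}, ∑' p, ENNReal.ofReal (c p * I p t ^ 2) with hS
    have hcl : IsClosed {x : ℝ | ∑ p ∈ s, ENNReal.ofReal (c p * I p x ^ 2) ≤ S} := by
      refine isClosed_le (continuous_finsetSum _ fun p _ => ?_) continuous_const
      exact ENNReal.continuous_ofReal.comp (continuous_const.mul ((hIc p).pow 2))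
    have hdense := (show Dense (range ((↑) : ℚ → ℝ)) from Rat.denseRange_cast).open_subset_closure_inter
      (isOpen_Ioo (a := (0 : ℝ)) (b := 1)) t.2
    refine (closure_minimal ?_ hcl) hdense
    rintro _ ⟨hx, q, rfl⟩
    refine (ENNReal.sum_le_tsum s).trans ?_
    exact le_iSup (fun t : {q : ℚ // 0 < q ∧ q < 1} => ∑' p, ENNReal.ofReal (c p * I p t ^ 2))
      ⟨q, by exact_mod_cast hx.1, by exact_mod_cast hx.2⟩

theorem gradualIntegral_const_mul (hh : IsChangeWeight h) (r : ℝ) (b : unitInterval → ℝ) (t : ℝ) :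
    gradualIntegral hh.boundedVariation (fun s => r * b s) t =
      r * gradualIntegral hh.boundedVariation b t := by
  rw [gradualIntegral, gradualIntegral, ← smul_eq_mul, ← VectorMeasure.integral_fun_smul]
  rfl

theorem rationalSup_sqrt_mul_eq (hh : IsChangeWeight h) {c lam : ℕ → ℝ} (hc : ∀ p, 0 ≤ c p)
    (hlam : ∀ p, 0 ≤ lam p) {b : ℕ → unitInterval → ℝ} (hb : ∀ p, Continuous (b p))
    (hb0 : ∀ p, b p 0 = 0) :
    rationalSup h c (fun q => √(lam q.1) * b q.1 (projIcc 0 1 zero_le_one (q.2 : ℝ))) =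
      esupWeighted (fun p => c p * lam p) fun p => gradualIntegral hh.boundedVariation (b p) := by
  rw [rationalSup_eq hh hc (b := fun p s => √(lam p) * b p s)
    (fun p => continuous_const.mul (hb p)) (fun p => by rw [hb0, mul_zero])]
  refine iSup_congr fun t => tsum_congr fun p => ?_
  dsimp only
  rw [gradualIntegral_const_mul hh, mul_pow, Real.sq_sqrt (hlam p), mul_assoc]

end Functional

/-! ### Coordinates of Hilbert space valued paths. -/

section HilbertPath

variable {H : Type*} [NormedAddCommGroup H] [InnerProductSpace ℝ H] [CompleteSpace H] {h : ℝ → ℝ}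

theorem one_sub_projIcc_one_sub (x : ℝ) :
    1 - (projIcc (0 : ℝ) 1 zero_le_one (1 - x) : ℝ) = projIcc (0 : ℝ) 1 zero_le_one x := by
  simp only [coe_projIcc]
  rcases le_total x 0 with h0 | h0
  · rw [min_eq_left (by linarith), min_eq_right (by linarith), max_eq_right zero_le_one,
      max_eq_left h0, sub_self]
  · rcases le_total x 1 with h1 | h1
    · rw [min_eq_right (by linarith), min_eq_right h1, max_eq_right h0,
        max_eq_right (by linarith)]
      ring
    · rw [min_eq_right (by linarith), min_eq_left h1, max_eq_right zero_le_one,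
        max_eq_left (by linarith), sub_zero]

theorem bridgePath_projIcc {E : Type*} [NormedAddCommGroup E] [NormedSpace ℝ E]
    (f : unitInterval → E) (x : ℝ) :
    bridgePath f (projIcc (0 : ℝ) 1 zero_le_one x) = bridgePath f x := by
  simp only [bridgePath, projIcc_val]

/-- Time reversal reconciles the two forms of the limit: `1 - (1 - t - y) = t + y`. -/
theorem gradualIntegral_inner_bridgePath (hh : IsChangeWeight h) {f : unitInterval → H}
    (hf : Continuous f) (v : H) {t : ℝ} (ht : t ∈ Ioo (0 : ℝ) 1) :
    gradualIntegral hh.boundedVariation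
      (fun s => inner ℝ v (bridgePath f (1 - (s : ℝ)))) t = inner ℝ v (bridgeIntegral hh f t) := by
  rw [gradualIntegral_eq hh (by simp [bridgePath_of_one_le]) ht]
  have hu : UniformContinuous fun y => bridgePath f (t + y) :=
    (uniformContinuous_bridgePath hf).comp (uniformContinuous_const.add uniformContinuous_id)
  have h1 := (innerSL ℝ v).map_setIntegral_signedMeasure hh.signedMeasure
    (fun a b ha hab hb => hh.vectorMeasure_Ioc ha hab hb) hu
  simp only [innerSL_apply_apply] at h1
  rw [bridgeIntegral, h1]
  congr 1
  funext y
  rw [IccExtend_apply, ← bridgePath_projIcc f (t + y), ← one_sub_projIcc_one_sub (t + y)]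
  rw [show 1 - (t + y) = 1 - t - y by ring]
  rfl

theorem bridgeIntegral_mem (hh : IsChangeWeight h) {f : unitInterval → H} (hf : Continuous f)
    {K : Submodule ℝ H} (hK : IsClosed (K : Set H)) (hfK : ∀ t, f t ∈ K) (t : ℝ) :
    bridgeIntegral hh f t ∈ K := by
  have hu : UniformContinuous fun y => bridgePath f (t + y) :=
    (uniformContinuous_bridgePath hf).comp (uniformContinuous_const.add uniformContinuous_id)
  refine hK.mem_of_tendsto (tendsto_stieltjesSum hh.signedMeasure
    (fun a b ha hab hb => hh.vectorMeasure_Ioc ha hab hb) hu) (Eventually.of_forall fun n => ?_)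
  exact K.sum_mem fun j _ => K.smul_mem _ (K.sub_mem (hfK _) (K.smul_mem _ (hfK _)))

/-- The scores of the reversed bridge of a path, at rational times. -/
noncomputable def bridgeScore (v : ℕ → H) (f : unitInterval → H) (q : ℕ × ℚ) : ℝ :=
  inner ℝ (v q.1) (bridgePath f (1 - (projIcc (0 : ℝ) 1 zero_le_one (q.2 : ℝ) : ℝ)))

/-- The integral stays in `K`, where `hR` sums the series to `‖R u‖²`; this is bounded in `t`
because the bridge is bounded. -/
theorem rationalSup_bridgeScore (hh : IsChangeWeight h) {c : ℕ → ℝ} (hc : ∀ p, 0 ≤ c p)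
    {v : ℕ → H} {R : H →L[ℝ] H} {K : Submodule ℝ H} (hK : IsClosed (K : Set H))
    (hR : ∀ x ∈ K, HasSum (fun p => c p * inner ℝ (v p) x ^ 2) (‖R x‖ ^ 2)) {f : unitInterval → H}
    (hf : Continuous f) (hfK : ∀ t, f t ∈ K) :
    rationalSup h c (bridgeScore v f) ≠ ⊤ ∧
      √(rationalSup h c (bridgeScore v f)).toReal =
        ⨆ t : Ioo (0 : ℝ) 1, ‖R (bridgeIntegral hh f t)‖ := by
  have hbc := (uniformContinuous_bridgePath hf).continuous
  have h1 : rationalSup h c (bridgeScore v f) =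
      esupWeighted c fun p t => inner ℝ (v p) (bridgeIntegral hh f t) := by
    have := rationalSup_eq hh hc (b := fun p s => inner ℝ (v p) (bridgePath f (1 - (s : ℝ))))
      (fun p => by fun_prop) (fun p => by simp [bridgePath_of_one_le])
    refine this.trans (iSup_congr fun t => tsum_congr fun p => ?_)
    dsimp only
    rw [gradualIntegral_inner_bridgePath hh hf _ t.2]
  have hs : ∀ t, HasSum (fun p => c p * inner ℝ (v p) (bridgeIntegral hh f t) ^ 2)
      (‖R (bridgeIntegral hh f t)‖ ^ 2) := fun t => hR _ (bridgeIntegral_mem hh hf hK hfK t)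
  obtain ⟨M, hM⟩ := exists_norm_bridgeIntegral_le hh hf
  have hfin : (esupWeighted c fun p t => inner ℝ (v p) (bridgeIntegral hh f t)) ≠ ⊤ := by
    refine ne_top_of_le_ne_top (b := ENNReal.ofReal ((‖R‖ * M) ^ 2)) ENNReal.ofReal_ne_top
      (iSup_le fun t => ?_)
    rw [← ENNReal.ofReal_tsum_of_nonneg (fun p => mul_nonneg (hc p) (sq_nonneg _))
      (hs t).summable, (hs t).tsum_eq]
    refine ENNReal.ofReal_le_ofReal (pow_le_pow_left₀ (norm_nonneg _) ?_ 2)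
    exact (R.le_opNorm _).trans (by gcongr; exact hM t)
  rw [h1]
  refine ⟨hfin, ?_⟩
  rw [← (supWeighted_of_esupWeighted_ne_top hc hfin).2]
  refine iSup_congr fun t => ?_
  rw [(hs t).tsum_eq, Real.sqrt_sq (norm_nonneg _)]

end HilbertPath

/-! ### Laws of Gaussian processes -/

section GaussianLaw

variable {Ω Ω' : Type*} [MeasurableSpace Ω] [MeasurableSpace Ω'] {P : Measure Ω} {P' : Measure Ω'}

/-- The characteristic function of a Gaussian vector involves only the mean and variance of each
linear functional, and bilinearity reduces these to the coordinates. -/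
theorem ProbabilityTheory.HasGaussianLaw.map_eq_of_covariance_eq {ι : Type*} [Fintype ι]
    [IsProbabilityMeasure P]
    [IsProbabilityMeasure P'] {X : ι → Ω → ℝ} {Y : ι → Ω' → ℝ}
    (hX : HasGaussianLaw (fun ω i => X i ω) P) (hY : HasGaussianLaw (fun ω i => Y i ω) P')
    (hmean : ∀ i, ∫ ω, X i ω ∂P = ∫ ω, Y i ω ∂P')
    (hcov : ∀ i j, cov[X i, X j; P] = cov[Y i, Y j; P']) :
    P.map (fun ω i => X i ω) = P'.map (fun ω i => Y i ω) := by
  classical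
  have := Measure.isProbabilityMeasure_map hX.aemeasurable
  have := Measure.isProbabilityMeasure_map hY.aemeasurable
  refine Measure.ext_of_charFunDual ?_
  ext L
  rw [hX.charFunDual_map_eq, hY.charFunDual_map_eq]
  have hXL : ∀ i, MemLp (fun ω => X i ω) 2 P := fun i => (hX.eval i).memLp_two
  have hYL : ∀ i, MemLp (fun ω => Y i ω) 2 P' := fun i => (hY.eval i).memLp_two
  have hL : ∀ x : ι → ℝ, L x = ∑ i, L (Pi.single i 1) * x i := fun x => by
    conv_lhs => rw [pi_eq_sum_univ' x]
    simp [map_sum, mul_comm]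
  have h1 : (L ∘ fun ω i => X i ω) = fun ω => ∑ i, L (Pi.single i 1) * X i ω :=
    funext fun ω => hL _
  have h2 : (L ∘ fun ω i => Y i ω) = fun ω => ∑ i, L (Pi.single i 1) * Y i ω :=
    funext fun ω => hL _
  rw [h1, h2, integral_finsetSum _ fun i _ => ((hXL i).integrable one_le_two).const_mul _,
    integral_finsetSum _ fun i _ => ((hYL i).integrable one_le_two).const_mul _,
    ← covariance_self (h1 ▸ (hX.map L).aemeasurable),
    ← covariance_self (h2 ▸ (hY.map L).aemeasurable),
    covariance_fun_sum_fun_sum (fun i => (hXL i).const_mul _) fun i => (hXL i).const_mul _,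
    covariance_fun_sum_fun_sum (fun i => (hYL i).const_mul _) fun i => (hYL i).const_mul _]
  simp only [integral_const_mul, hmean, covariance_const_mul_left, covariance_const_mul_right]
  simp only [show ∀ i j, cov[fun ω => X i ω, fun ω => X j ω; P] =
    cov[fun ω => Y i ω, fun ω => Y j ω; P'] from hcov]

/-- Finite-dimensional laws determine the law on the product, as a unique projective limit. -/
theorem ProbabilityTheory.IsGaussianProcess.map_eq_of_covariance_eq {T : Type*} [Countable T]
    [IsProbabilityMeasure P] [IsProbabilityMeasure P'] {X : T → Ω → ℝ} {Y : T → Ω' → ℝ}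
    (hX : IsGaussianProcess X P) (hY : IsGaussianProcess Y P')
    (hmean : ∀ i, ∫ ω, X i ω ∂P = ∫ ω, Y i ω ∂P')
    (hcov : ∀ i j, cov[X i, X j; P] = cov[Y i, Y j; P']) :
    P.map (fun ω i => X i ω) = P'.map (fun ω i => Y i ω) := by
  have h1 := isProjectiveLimit_map (aemeasurable_pi_lambda (fun ω t => X t ω) hX.aemeasurable)
  have h2 := isProjectiveLimit_map (aemeasurable_pi_lambda (fun ω t => Y t ω) hY.aemeasurable)
  have h3 : (fun I : Finset T => P.map fun ω => I.restrict (X · ω)) =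
      fun I : Finset T => P'.map fun ω => I.restrict (Y · ω) := funext fun I =>
    HasGaussianLaw.map_eq_of_covariance_eq (X := fun i : I => X i) (Y := fun i : I => Y i)
      (hX.hasGaussianLaw I) (hY.hasGaussianLaw I) (fun i => hmean i) (fun i j => hcov i j)
  rw [← h3] at h2
  exact h1.unique h2

end GaussianLaw

/-! ### The scores of a Hilbert space valued Brownian motion -/

section BrownianMotion

variable {H : Type*} [NormedAddCommGroup H] [InnerProductSpace ℝ H]

theorem bridgeScore_eq (v : ℕ → H) (f : unitInterval → H) (q : ℕ × ℚ) :
    bridgeScore v f q =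
      inner ℝ (v q.1) (f (unitInterval.symm (projIcc (0 : ℝ) 1 zero_le_one (q.2 : ℝ)))) -
        (1 - (projIcc (0 : ℝ) 1 zero_le_one (q.2 : ℝ) : ℝ)) * inner ℝ (v q.1) (f 1) := by
  set r := projIcc (0 : ℝ) 1 zero_le_one (q.2 : ℝ)
  have h1 : projIcc (0 : ℝ) 1 zero_le_one (1 - (r : ℝ)) = unitInterval.symm r := by
    rw [← unitInterval.coe_symm_eq, projIcc_val]
  rw [bridgeScore, bridgePath, h1, inner_sub_right, inner_smul_right, unitInterval.coe_symm_eq]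

variable [MeasurableSpace H] {Ω : Type*} [MeasurableSpace Ω] {P : Measure Ω}
  {C : H →L[ℝ] H} {W : Ω → CadlagPath H}

theorem IsHilbertBrownianMotion.hasLaw_inner
    (hW : IsHilbertBrownianMotion C W P) (t : unitInterval) (x : H) :
    HasLaw (fun ω => inner ℝ x (W ω t))
      (gaussianReal 0 ((t : ℝ) * inner ℝ x (C x)).toNNReal) P := by
  have h1 := hW.gaussian 0 t unitInterval.nonneg' x
  rw [Icc.coe_zero, sub_zero] at h1
  refine h1.congr ?_
  filter_upwards [hW.zero] with ω hω
  rw [hω, sub_zero]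

theorem IsHilbertBrownianMotion.memLp_inner
    (hW : IsHilbertBrownianMotion C W P) (t : unitInterval) (x : H) :
    MemLp (fun ω => inner ℝ x (W ω t)) 2 P :=
  (hW.hasLaw_inner t x).hasGaussianLaw.memLp_two

theorem IsHilbertBrownianMotion.integral_inner
    (hW : IsHilbertBrownianMotion C W P) (t : unitInterval) (x : H) :
    ∫ ω, inner ℝ x (W ω t) ∂P = 0 := by
  rw [(hW.hasLaw_inner t x).integral_eq, integral_id_gaussianReal]

theorem IsHilbertBrownianMotion.integral_bridgeScore [IsProbabilityMeasure P]
    (hW : IsHilbertBrownianMotion C W P) (v : ℕ → H) (q : ℕ × ℚ) :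
    ∫ ω, bridgeScore v (W ω) q ∂P = 0 := by
  simp only [bridgeScore_eq]
  rw [integral_sub ((hW.memLp_inner _ _).integrable one_le_two)
    (((hW.memLp_inner _ _).integrable one_le_two).const_mul _), integral_const_mul,
    hW.integral_inner, hW.integral_inner, mul_zero, sub_zero]

variable [SecondCountableTopology H]

/-- For `x ⟂ K` the variance `t ⟨x, C x⟩` is zero. Countable dense sets of `x` and `t`, with
continuity, give one null set for all of them, and `Kᗮᗮ = K`. -/
theorem IsHilbertBrownianMotion.ae_mem [CompleteSpace H]
    (hW : IsHilbertBrownianMotion C W P) {K : Submodule ℝ H} (hK : IsClosed (K : Set H))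
    (hCK : ∀ x ∈ Kᗮ, C x = 0) : ∀ᵐ ω ∂P, ∀ t, W ω t ∈ K := by
  have h1 : ∀ x ∈ Kᗮ, ∀ t, ∀ᵐ ω ∂P, inner ℝ x (W ω t) = 0 := fun x hx t => by
    have := hW.hasLaw_inner t x
    rw [hCK x hx, inner_zero_right, mul_zero, Real.toNNReal_zero, gaussianReal_zero_var] at this
    exact this.ae_eq_of_dirac
  have h2 : ∀ᵐ ω ∂P, ∀ i j : ℕ, inner ℝ (TopologicalSpace.denseSeq Kᗮ i : H)
      (W ω (TopologicalSpace.denseSeq unitInterval j)) = 0 := by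
    simp only [ae_all_iff]
    exact fun i j => h1 _ (TopologicalSpace.denseSeq Kᗮ i).2 _
  filter_upwards [h2, hW.cont] with ω hω hc t
  have hK' : Kᗮᗮ = K := by
    rw [Submodule.orthogonal_orthogonal_eq_closure, hK.submodule_topologicalClosure_eq]
  rw [← hK', Submodule.mem_orthogonal]
  intro x hx
  have h3 : ∀ j : ℕ, ∀ y : Kᗮ,
      inner ℝ (y : H) (W ω (TopologicalSpace.denseSeq unitInterval j)) = 0 := by
    intro j y
    refine (TopologicalSpace.denseRange_denseSeq Kᗮ).induction_on (p := fun y : Kᗮ =>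
      inner ℝ (y : H) (W ω (TopologicalSpace.denseSeq unitInterval j)) = 0) y ?_ fun i => hω i j
    exact isClosed_eq (by fun_prop) continuous_const
  refine (TopologicalSpace.denseRange_denseSeq unitInterval).induction_on
    (p := fun t => inner ℝ x (W ω t) = 0) t ?_ fun j => h3 j ⟨x, hx⟩
  exact isClosed_eq (continuous_const.inner hc) continuous_const

variable [BorelSpace H]

/-- At equal times the variances determine it by polarization; the increment after the earlier time
is independent and contributes nothing. -/
theorem IsHilbertBrownianMotion.covariance_inner [IsProbabilityMeasure P]
    (hW : IsHilbertBrownianMotion C W P) (hC : ∀ x, 0 ≤ inner ℝ x (C x))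
    (hC' : ∀ x y, inner ℝ x (C y) = inner ℝ y (C x)) (s t : unitInterval) (x y : H) :
    cov[fun ω => inner ℝ x (W ω s), fun ω => inner ℝ y (W ω t); P] =
      min (s : ℝ) t * inner ℝ x (C y) := by
  wlog hst : s ≤ t generalizing s t x y
  · rw [covariance_comm, this t s y x (le_of_not_ge hst), min_comm, hC']
  have hvar : ∀ z, Var[fun ω => inner ℝ z (W ω s); P] = s * inner ℝ z (C z) := fun z => by
    rw [(hW.hasLaw_inner s z).variance_eq, variance_id_gaussianReal,
      Real.coe_toNNReal _ (mul_nonneg s.2.1 (hC z))]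
  have h1 : cov[fun ω => inner ℝ x (W ω s), fun ω => inner ℝ y (W ω s); P] =
      s * inner ℝ x (C y) := by
    have h2 := variance_fun_add (hW.memLp_inner s x) (hW.memLp_inner s y)
    have h3 := hvar (x + y)
    simp only [inner_add_left, map_add, inner_add_right] at h3
    rw [h2, hvar, hvar, hC' y x] at h3
    linarith
  have hind : IndepFun (fun ω => W ω s) (fun ω => W ω t - W ω s) P :=
    hW.indep.indepFun_eval_sub unitInterval.nonneg' hst hW.zero
  have h4 : cov[fun ω => inner ℝ x (W ω s), fun ω => inner ℝ y (W ω t - W ω s); P] = 0 := by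
    refine IndepFun.covariance_eq_zero ?_ (hW.memLp_inner s x) ?_
    · exact hind.comp (φ := fun z => inner ℝ x z) (ψ := fun z => inner ℝ y z) (by fun_prop)
        (by fun_prop)
    · simp only [inner_sub_right]
      exact (hW.memLp_inner t y).sub (hW.memLp_inner s y)
  simp only [inner_sub_right] at h4
  rw [covariance_fun_sub_right (hW.memLp_inner s x) (hW.memLp_inner t y) (hW.memLp_inner s y),
    h1] at h4
  rw [min_eq_left (show (s : ℝ) ≤ t from hst)]
  linarith

/-- The bridge covariance `min s t - s t` is invariant under `s ↦ 1 - s`, so the time reversal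
leaves no trace. -/
theorem IsHilbertBrownianMotion.covariance_bridgeScore [IsProbabilityMeasure P]
    (hW : IsHilbertBrownianMotion C W P) (hC : ∀ x, 0 ≤ inner ℝ x (C x))
    (hC' : ∀ x y, inner ℝ x (C y) = inner ℝ y (C x)) (v : ℕ → H) (q q' : ℕ × ℚ) :
    cov[fun ω => bridgeScore v (W ω) q, fun ω => bridgeScore v (W ω) q'; P] =
      (min (projIcc (0 : ℝ) 1 zero_le_one (q.2 : ℝ) : ℝ) (projIcc (0 : ℝ) 1 zero_le_one (q'.2 : ℝ)) -
        (projIcc (0 : ℝ) 1 zero_le_one (q.2 : ℝ) : ℝ) * projIcc (0 : ℝ) 1 zero_le_one (q'.2 : ℝ)) *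
      inner ℝ (v q.1) (C (v q'.1)) := by
  simp only [bridgeScore_eq]
  set r := projIcc (0 : ℝ) 1 zero_le_one (q.2 : ℝ)
  set r' := projIcc (0 : ℝ) 1 zero_le_one (q'.2 : ℝ)
  rw [covariance_fun_sub_fun_sub (hW.memLp_inner _ _) ((hW.memLp_inner _ _).const_mul _)
    (hW.memLp_inner _ _) ((hW.memLp_inner _ _).const_mul _)]
  simp only [covariance_const_mul_left, covariance_const_mul_right,
    hW.covariance_inner hC hC', unitInterval.coe_symm_eq, Icc.coe_one]
  have hr := r.2
  have hr' := r'.2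
  rw [min_eq_left (by linarith [hr.1] : 1 - (r : ℝ) ≤ 1),
    min_eq_right (by linarith [hr'.1] : 1 - (r' : ℝ) ≤ 1), min_self]
  rcases le_total (r : ℝ) r' with h | h
  · rw [min_eq_right (by linarith), min_eq_left h]
    ring
  · rw [min_eq_left (by linarith), min_eq_right h]
    ring

variable [CompleteSpace H]

theorem IsHilbertBrownianMotion.isGaussianProcess
    (hW : IsHilbertBrownianMotion C W P) : IsGaussianProcess (fun t ω => W ω t) P := by
  refine HasIndepIncrements.isGaussianProcess (fun t => ⟨?_⟩) hW.zero hW.indep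
  refine isGaussian_of_map_eq_gaussianReal fun L => ?_
  have h1 := hW.hasLaw_inner t ((InnerProductSpace.toDual ℝ H).symm L)
  simp only [InnerProductSpace.toDual_symm_apply] at h1
  exact ⟨_, _, (AEMeasurable.map_map_of_aemeasurable L.continuous.measurable.aemeasurable
    (hW.aemeasurable t)).trans h1.map_eq⟩

theorem IsHilbertBrownianMotion.isGaussianProcess_bridgeScore
    (hW : IsHilbertBrownianMotion C W P) (v : ℕ → H) :
    IsGaussianProcess (fun q ω => bridgeScore v (W ω) q) P := by
  classical
  refine hW.isGaussianProcess.of_isGaussianProcess fun q => ?_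
  set r := projIcc (0 : ℝ) 1 zero_le_one (q.2 : ℝ)
  refine ⟨{unitInterval.symm r, 1},
    innerSL ℝ (v q.1) ∘L (ContinuousLinearMap.proj ⟨unitInterval.symm r, by simp⟩) -
      (1 - (r : ℝ)) • innerSL ℝ (v q.1) ∘L (ContinuousLinearMap.proj ⟨1, by simp⟩), fun ω => ?_⟩
  rw [bridgeScore_eq]
  simp [r]

end BrownianMotion

/-! ### Independent Brownian bridges -/

section BrownianBridge

variable {Ω : Type*} [MeasurableSpace Ω] {P : Measure Ω} {B : ℕ → unitInterval → Ω → ℝ}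

/-- Independent Gaussian vectors are jointly Gaussian. The finite index set is enlarged to a
rectangle `J × K`, so that independence over `p` applies. -/
theorem isGaussianProcess_smul_brownianBridge (hB : ∀ p, IsBrownianBridge (B p) P)
    (hind : iIndepFun (fun p ω t => B p t ω) P) (c : ℕ → ℝ) :
    IsGaussianProcess (fun (q : ℕ × ℚ) ω =>
      c q.1 * B q.1 (projIcc (0 : ℝ) 1 zero_le_one (q.2 : ℝ)) ω) P where
  hasGaussianLaw I := by
    classical
    set J := I.image Prod.fst
    set K := I.image Prod.snd
    have h1 : iIndepFun (fun (p : J) ω (k : K) =>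
        B p (projIcc (0 : ℝ) 1 zero_le_one ((k : ℚ) : ℝ)) ω) P :=
      (hind.precomp Subtype.val_injective).comp
        (fun _ x (k : K) => x (projIcc (0 : ℝ) 1 zero_le_one ((k : ℚ) : ℝ)))
        fun _ => measurable_pi_lambda _ fun _ => measurable_pi_apply _
    have h2 : ∀ p : J, HasGaussianLaw (fun ω (k : K) =>
        B p (projIcc (0 : ℝ) 1 zero_le_one ((k : ℚ) : ℝ)) ω) P := fun p =>
      ((hB p).gaussian.comp_right
        fun k : ℚ => projIcc (0 : ℝ) 1 zero_le_one (k : ℝ)).hasGaussianLaw K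
    have h3 := h1.hasGaussianLaw h2
    let L : (J → K → ℝ) →L[ℝ] I → ℝ := ContinuousLinearMap.pi fun i =>
      c i.1.1 • (ContinuousLinearMap.proj (R := ℝ) (φ := fun _ : K => ℝ)
        ⟨i.1.2, Finset.mem_image_of_mem _ i.2⟩ ∘L
        ContinuousLinearMap.proj (R := ℝ) (φ := fun _ : J => K → ℝ)
        ⟨i.1.1, Finset.mem_image_of_mem _ i.2⟩)
    exact h3.map L

theorem covariance_smul_brownianBridge (hB : ∀ p, IsBrownianBridge (B p) P)
    (hind : iIndepFun (fun p ω t => B p t ω) P) (c : ℕ → ℝ) (p p' : ℕ) (s t : unitInterval) :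
    cov[fun ω => c p * B p s ω, fun ω => c p' * B p' t ω; P] =
      if p = p' then c p ^ 2 * (min (s : ℝ) t - s * t) else 0 := by
  have := (hB 0).gaussian.isProbabilityMeasure
  rw [covariance_const_mul_left, covariance_const_mul_right]
  split_ifs with hp
  · subst hp
    rw [show cov[fun ω => B p s ω, fun ω => B p t ω; P] = _ from (hB p).cov s t]
    ring
  · have h1 : IndepFun (B p s) (B p' t) P :=
      (hind.indepFun hp).comp (measurable_pi_apply s) (measurable_pi_apply t)
    rw [show cov[fun ω => B p s ω, fun ω => B p' t ω; P] = 0 from h1.covariance_eq_zero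
      ((hB p).gaussian.hasGaussianLaw_eval s).memLp_two
      ((hB p').gaussian.hasGaussianLaw_eval t).memLp_two]
    ring

/-- The variance at time `0` is zero. -/
theorem IsBrownianBridge.ae_zero {b : unitInterval → Ω → ℝ} (hb : IsBrownianBridge b P) :
    ∀ᵐ ω ∂P, b 0 ω = 0 := by
  have := hb.gaussian.isProbabilityMeasure
  have h1 := hb.gaussian.hasGaussianLaw_eval 0
  have h2 : Var[b 0; P] = 0 := by
    rw [← covariance_self h1.aemeasurable, hb.cov]
    simp
  have h3 := h1.map_eq_gaussianReal
  rw [h2, Real.toNNReal_zero, gaussianReal_zero_var, hb.centered] at h3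
  exact (HasLaw.mk h1.aemeasurable h3).ae_eq_of_dirac

end BrownianBridge

/-! ### Inverse square roots and the largest eigenvalue under perturbations -/

section Operators

variable {H : Type*} [NormedAddCommGroup H] [InnerProductSpace ℝ H]

/-- A self-adjoint operator whose quadratic form lies between `0` and `r ‖x‖²` has norm at most
`r`. -/
theorem norm_le_of_inner_le {T : H →L[ℝ] H} (hT : (T : H →ₗ[ℝ] H).IsSymmetric) {r : ℝ}
    (hr : 0 ≤ r) (h0 : ∀ x, 0 ≤ inner ℝ (T x) x) (h1 : ∀ x, inner ℝ (T x) x ≤ r * ‖x‖ ^ 2) :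
    ‖T‖ ≤ r := by
  rw [T.norm_eq_iSup_rayleighQuotient hT]
  refine ciSup_le fun x => ?_
  simp only [ContinuousLinearMap.rayleighQuotient, ContinuousLinearMap.reApplyInnerSelf_apply,
    RCLike.re_to_real]
  rw [abs_of_nonneg (div_nonneg (h0 x) (sq_nonneg _))]
  exact div_le_of_le_mul₀ (sq_nonneg _) hr (h1 x)

variable [CompleteSpace H]

theorem isUnit_of_mul_norm_sq_le_inner {B : H →L[ℝ] H} {c : ℝ} (hc : 0 < c)
    (h : ∀ x, c * ‖x‖ ^ 2 ≤ inner ℝ (B x) x) : IsUnit B := by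
  refine B.isUnit_of_forall_le_norm_inner_map (c := ⟨c, hc.le⟩) hc fun x => ?_
  rw [mul_comm]
  exact (h x).trans (Real.le_norm_self _)

/-- A self-adjoint operator `T` with `‖T‖ < 1` is of the form `2X - X²` with `X` self-adjoint and
`‖X‖ ≤ ‖T‖`. -/
theorem exists_two_smul_sub_sq_eq {T : H →L[ℝ] H} (hT : IsSelfAdjoint T) (h1 : ‖T‖ < 1) :
    ∃ X : H →L[ℝ] H, IsSelfAdjoint X ∧ ‖X‖ ≤ ‖T‖ ∧ (2 : ℝ) • X - X * X = T := by
  set s : Set (H →L[ℝ] H) := {X | IsSelfAdjoint X ∧ ‖X‖ ≤ ‖T‖} with hs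
  have hsc : IsComplete s := by
    refine IsClosed.isComplete (IsClosed.inter ?_ ?_)
    · exact isClosed_eq continuous_star continuous_id
    · exact isClosed_le continuous_norm continuous_const
  -- A fixed point satisfies `2X = T + X²`. On the ball of radius `‖T‖ < 1` the map is a contraction
  -- with constant `‖T‖`.
  set f : (H →L[ℝ] H) → H →L[ℝ] H := fun X => (2 : ℝ)⁻¹ • (T + X * X) with hf
  have hsf : MapsTo f s s := by
    intro X hX
    refine ⟨?_, ?_⟩
    · refine IsSelfAdjoint.smul (by simp [IsSelfAdjoint]) (hT.add ?_)
      rw [IsSelfAdjoint, star_mul, hX.1.star_eq]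
    · have : ‖X * X‖ ≤ ‖T‖ := (norm_mul_le _ _).trans (by
        nlinarith [norm_nonneg X, norm_nonneg T, hX.2])
      calc ‖f X‖ ≤ 2⁻¹ * (‖T‖ + ‖X * X‖) := by
            rw [hf, norm_smul]
            have := norm_add_le T (X * X)
            norm_num
            linarith
        _ ≤ ‖T‖ := by linarith
  have hcon : ContractingWith ⟨‖T‖, norm_nonneg _⟩ (MapsTo.restrict f s s hsf) := by
    refine ⟨by exact_mod_cast h1, LipschitzWith.of_dist_le_mul fun X Y => ?_⟩
    change dist (f X) (f Y) ≤ ‖T‖ * dist (X : H →L[ℝ] H) Y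
    rw [dist_eq_norm, dist_eq_norm]
    have e : f X - f Y = (2 : ℝ)⁻¹ • ((X : H →L[ℝ] H) * (X - Y) + (X - Y) * Y) := by
      simp only [hf, ← smul_sub]
      congr 1
      noncomm_ring
    rw [e, norm_smul]
    have a1 : ‖(X : H →L[ℝ] H) * (X - Y)‖ ≤ ‖T‖ * ‖(X : H →L[ℝ] H) - Y‖ :=
      (norm_mul_le _ _).trans (mul_le_mul_of_nonneg_right X.2.2 (norm_nonneg _))
    have a2 : ‖((X : H →L[ℝ] H) - Y) * Y‖ ≤ ‖T‖ * ‖(X : H →L[ℝ] H) - Y‖ := by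
      refine (norm_mul_le _ _).trans ?_
      rw [mul_comm]
      exact mul_le_mul_of_nonneg_right Y.2.2 (norm_nonneg _)
    have := norm_add_le ((X : H →L[ℝ] H) * (X - Y)) ((X - Y) * Y)
    norm_num
    linarith
  obtain ⟨X, hX, hfix, -⟩ := hcon.exists_fixedPoint' hsc hsf (x := 0)
    ⟨IsSelfAdjoint.zero _, by simp⟩ (edist_ne_top _ _)
  refine ⟨X, hX.1, hX.2, ?_⟩
  have h2 : (2 : ℝ) • X = T + X * X := by
    conv_lhs => rw [← hfix.eq]
    simp [hf, smul_smul]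
  rw [h2, add_sub_cancel_right]

/-- A self-adjoint operator that is bounded below by a positive constant has an inverse square
root. -/
theorem exists_isInvSqrt {B : H →L[ℝ] H} (hB : IsSelfAdjoint B) {c : ℝ} (hc : 0 < c)
    (h : ∀ x, c * ‖x‖ ^ 2 ≤ inner ℝ (B x) x) : ∃ R, IsInvSqrt B R := by
  -- With this scaling `c/K ≤ B/K ≤ 1` as forms, hence `T = 1 - B/K` has norm at most `1 - c/K < 1`.
  set K : ℝ := ‖B‖ + c with hK
  have hK0 : 0 < K := by positivity
  have hcK : c ≤ K := by rw [hK]; linarith [norm_nonneg B]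
  set T : H →L[ℝ] H := 1 - K⁻¹ • B with hTdef
  have hTs : IsSelfAdjoint T := by
    refine (IsSelfAdjoint.one _).sub (IsSelfAdjoint.smul (by simp [IsSelfAdjoint]) hB)
  have hTin : ∀ x, inner ℝ (T x) x = ‖x‖ ^ 2 - K⁻¹ * inner ℝ (B x) x := by
    intro x
    simp [hTdef, inner_sub_left, real_inner_smul_left]
  have hT1 : ‖T‖ < 1 := by
    have hcK' : 0 < c / K := by positivity
    refine lt_of_le_of_lt (norm_le_of_inner_le (r := 1 - c / K) hTs.isSymmetric ?_ ?_ ?_) ?_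
    · rw [sub_nonneg, div_le_one hK0]; exact hcK
    · intro x
      rw [hTin, sub_nonneg, inv_mul_le_iff₀ hK0]
      have h1 : inner ℝ (B x) x ≤ ‖B‖ * ‖x‖ * ‖x‖ := (real_inner_le_norm _ _).trans
        (mul_le_mul_of_nonneg_right (B.le_opNorm x) (norm_nonneg _))
      nlinarith [sq_nonneg ‖x‖]
    · intro x
      rw [hTin]
      have : c / K * ‖x‖ ^ 2 ≤ K⁻¹ * inner ℝ (B x) x := by
        rw [div_eq_inv_mul, mul_assoc]
        exact mul_le_mul_of_nonneg_left (h x) (by positivity)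
      linarith
    · linarith
  obtain ⟨X, hXs, hXT, hX⟩ := exists_two_smul_sub_sq_eq hTs hT1
  -- `(1 - X)² = 1 - T = B/K`, so `Q² = B`. As `‖X‖ ≤ ‖T‖ < 1`, `Q` is bounded below, and its
  -- inverse is the required `R`.
  set Q : H →L[ℝ] H := √K • (1 - X) with hQdef
  have hQs : IsSelfAdjoint Q :=
    IsSelfAdjoint.smul (by simp [IsSelfAdjoint]) ((IsSelfAdjoint.one _).sub hXs)
  have hQQ : Q * Q = B := by
    have e : (1 - X) * (1 - X) = K⁻¹ • B := by
      have : (1 - X) * (1 - X) = 1 - ((2 : ℝ) • X - X * X) := by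
        rw [two_smul]; noncomm_ring
      rw [this, hX, hTdef, sub_sub_cancel]
    rw [hQdef, smul_mul_smul_comm, e, smul_smul, Real.mul_self_sqrt hK0.le,
      mul_inv_cancel₀ hK0.ne', one_smul]
  have hc' : 0 < √K * (1 - ‖T‖) := mul_pos (Real.sqrt_pos.2 hK0) (by linarith)
  have hQp : ∀ x, √K * (1 - ‖T‖) * ‖x‖ ^ 2 ≤ inner ℝ (Q x) x := by
    intro x
    have e : inner ℝ (Q x) x = √K * (‖x‖ ^ 2 - inner ℝ (X x) x) := by
      simp [hQdef, inner_sub_left, real_inner_smul_left]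
    have h1 : inner ℝ (X x) x ≤ ‖T‖ * ‖x‖ * ‖x‖ := (real_inner_le_norm _ _).trans
      (mul_le_mul_of_nonneg_right ((X.le_opNorm x).trans
        (mul_le_mul_of_nonneg_right hXT (norm_nonneg _))) (norm_nonneg _))
    rw [e, mul_assoc]
    refine mul_le_mul_of_nonneg_left ?_ (Real.sqrt_nonneg _)
    nlinarith
  obtain ⟨u, hu⟩ := isUnit_of_mul_norm_sq_le_inner hc' hQp
  set R : H →L[ℝ] H := ((u⁻¹ : (H →L[ℝ] H)ˣ) : H →L[ℝ] H) with hR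
  have hQR : Q * R = 1 := by rw [← hu, hR]; exact u.mul_inv
  have hRQ : R * Q = 1 := by rw [← hu, hR]; exact u.inv_mul
  refine ⟨R, ?_, fun x hx => ?_, ?_⟩
  · have : star R * Q = 1 := by
      rw [← hQs.star_eq, ← star_mul, hQR, star_one]
    calc star R = star R * (Q * R) := by rw [hQR, mul_one]
      _ = R := by rw [← mul_assoc, this, one_mul]
  · have hx' : Q (R x) = x := by
      have := congrArg (fun L : H →L[ℝ] H => L x) hQR
      simpa using this
    have hRx : R x ≠ 0 := by
      intro h0
      rw [h0, map_zero] at hx'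
      exact hx hx'.symm
    have h2 := hQp (R x)
    rw [hx', real_inner_comm] at h2
    refine lt_of_lt_of_le ?_ h2
    have := norm_pos_iff.2 hRx
    positivity
  · change R * (B * R) = 1
    rw [← hQQ, mul_assoc, hQR, mul_one, hRQ]

/-- `y = R² w` is `B⁻¹ w`. Norms of `R w` are thus read off the inverse of `B`, and no perturbation
theory for square roots is needed. -/
theorem IsInvSqrt.exists_inner_eq {B R : H →L[ℝ] H} (h : IsInvSqrt B R) (w : H) :
    ∃ y, B y = w ∧ ‖R w‖ ^ 2 = inner ℝ y w := by
  have h3 : R * (B * R) = 1 := h.2.2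
  have hBRR : B * R * R = 1 := by
    have h4 : IsUnit R := by
      refine ⟨⟨R, B * R, h3, ?_⟩, rfl⟩
      have e1 : (R * B) * R = 1 := by rw [mul_assoc, h3]
      have e2 : R * B = B * R := by
        calc R * B = (R * B) * (R * (B * R)) := by rw [h3, mul_one]
          _ = (R * B) * R * (B * R) := by simp only [mul_assoc]
          _ = B * R := by rw [e1, one_mul]
      rw [← e2, e1]
    obtain ⟨u, hu⟩ := h4
    rw [← hu] at h3 ⊢
    have e2 : B * u = u⁻¹ := by
      rw [← Units.inv_mul_cancel_left u (B * u), h3, mul_one]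
    rw [e2, Units.inv_mul]
  refine ⟨R (R w), ?_, ?_⟩
  · have := congrArg (fun L : H →L[ℝ] H => L w) hBRR
    simpa using this
  · have := h.1.isSymmetric (R w) w
    simp only [ContinuousLinearMap.coe_coe] at this
    rw [this, real_inner_self_eq_norm_sq]

theorem isInvSqrt_invSqrt {B : H →L[ℝ] H} (h : ∃ R, IsInvSqrt B R) : IsInvSqrt B (invSqrt B) := by
  rw [invSqrt, dif_pos h]
  exact h.choose_spec

/-- Inverse square roots depend continuously on the operator. -/
theorem IsInvSqrt.abs_norm_sub_norm_le {B B' R R' : H →L[ℝ] H} (hR : IsInvSqrt B R)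
    (hR' : IsInvSqrt B' R') {c : ℝ} (hc : 0 < c) (hB : ∀ x, c * ‖x‖ ^ 2 ≤ inner ℝ (B x) x)
    (hB' : ∀ x, c * ‖x‖ ^ 2 ≤ inner ℝ (B' x) x) (w : H) :
    |‖R w‖ - ‖R' w‖| ≤ √‖B - B'‖ / c * ‖w‖ := by
  have below : ∀ {B : H →L[ℝ] H}, (∀ x, c * ‖x‖ ^ 2 ≤ inner ℝ (B x) x) →
      ∀ x, c * ‖x‖ ≤ ‖B x‖ := by
    intro B hB x
    rcases (norm_nonneg x).eq_or_lt with h0 | h0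
    · rw [← h0, mul_zero]; exact norm_nonneg _
    · refine le_of_mul_le_mul_right ?_ h0
      calc c * ‖x‖ * ‖x‖ = c * ‖x‖ ^ 2 := by ring
        _ ≤ _ := (hB x).trans (real_inner_le_norm _ _)
  obtain ⟨y, hy, hRy⟩ := hR.exists_inner_eq w
  obtain ⟨y', hy', hRy'⟩ := hR'.exists_inner_eq w
  -- The resolvent identity applied to `w`.
  have h1 : B (y - y') = -((B - B') y') := by
    simp [map_sub, hy, hy']
  have h2 : c * ‖y - y'‖ ≤ ‖B - B'‖ * ‖y'‖ := by
    refine (below hB _).trans ?_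
    rw [h1, norm_neg]
    exact (B - B').le_opNorm y'
  have h3 : c * ‖y'‖ ≤ ‖w‖ := by simpa [hy'] using below hB' y'
  have h4 : c * (c * ‖y - y'‖) ≤ ‖B - B'‖ * ‖w‖ := by
    calc c * (c * ‖y - y'‖) ≤ c * (‖B - B'‖ * ‖y'‖) := mul_le_mul_of_nonneg_left h2 hc.le
      _ = ‖B - B'‖ * (c * ‖y'‖) := by ring
      _ ≤ _ := mul_le_mul_of_nonneg_left h3 (norm_nonneg _)
  have h5 : |‖R w‖ ^ 2 - ‖R' w‖ ^ 2| ≤ ‖B - B'‖ / c ^ 2 * ‖w‖ ^ 2 := by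
    rw [hRy, hRy', ← inner_sub_left]
    refine (abs_real_inner_le_norm _ _).trans ?_
    have : ‖y - y'‖ ≤ ‖B - B'‖ / c ^ 2 * ‖w‖ := by
      rw [div_mul_eq_mul_div, le_div_iff₀ (by positivity)]
      linarith
    calc ‖y - y'‖ * ‖w‖ ≤ ‖B - B'‖ / c ^ 2 * ‖w‖ * ‖w‖ :=
          mul_le_mul_of_nonneg_right this (norm_nonneg _)
      _ = _ := by ring
  -- `(a - b)² ≤ |a² - b²|` for nonnegative `a`, `b`; this is the source of the square root in the
  -- bound.
  have h6 : |‖R w‖ - ‖R' w‖| ^ 2 ≤ |‖R w‖ ^ 2 - ‖R' w‖ ^ 2| := by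
    rw [sq_sub_sq, abs_mul, pow_two]
    refine mul_le_mul_of_nonneg_right ?_ (abs_nonneg _)
    rw [abs_of_nonneg (add_nonneg (norm_nonneg _) (norm_nonneg _)), abs_le]
    constructor <;> linarith [norm_nonneg (R w), norm_nonneg (R' w)]
  refine abs_le_of_sq_le_sq' (a := |‖R w‖ - ‖R' w‖|) ?_ (by positivity) |>.2
  refine (h6.trans h5).trans (le_of_eq ?_)
  rw [mul_pow, div_pow, Real.sq_sqrt (norm_nonneg _)]

/-- If the quadratic form of a small perturbation `A` of a compact operator attains values near
the supremum, it attains the supremum: the largest eigenvalue of `A` is the supremum of the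
quadratic form. -/
theorem isGreatest_eigenvalue {C A : H →L[ℝ] H} (hC : IsCompactOperator C)
    (hA : IsSelfAdjoint A) {M δ : ℝ} (hδ : ‖A - C‖ ≤ δ) (hδM : δ < M)
    (hM : IsLUB ((fun x => inner ℝ (A x) x) '' Metric.sphere (0 : H) 1) M) :
    IsGreatest {r : ℝ | Module.End.HasEigenvalue (A : H →ₗ[ℝ] H) r} M := by
  have hAM : ∀ x, inner ℝ (A x) x ≤ M * ‖x‖ ^ 2 := by
    intro x
    by_cases hx : x = 0
    · simp [hx]
    have hx' : 0 < ‖x‖ := norm_pos_iff.2 hx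
    have h1 : inner ℝ (A (‖x‖⁻¹ • x)) (‖x‖⁻¹ • x) ≤ M :=
      hM.1 ⟨_, by simp [norm_smul, inv_mul_cancel₀ hx'.ne'], rfl⟩
    rw [map_smul, real_inner_smul_left, real_inner_smul_right] at h1
    have e : inner ℝ (A x) x = ‖x‖ ^ 2 * (‖x‖⁻¹ * (‖x‖⁻¹ * inner ℝ (A x) x)) := by field_simp
    rw [e, mul_comm M]
    exact mul_le_mul_of_nonneg_left h1 (sq_nonneg _)
  refine ⟨?_, fun r hr => ?_⟩
  swap
  · obtain ⟨x, hx⟩ := hr.exists_hasEigenvector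
    have h1 : A x = r • x := hx.apply_eq_smul
    have h2 := hAM x
    rw [h1, real_inner_smul_left, real_inner_self_eq_norm_sq] at h2
    have := norm_pos_iff.2 hx.2
    exact le_of_mul_le_mul_right h2 (by positivity)
  set S : H →L[ℝ] H := M • ContinuousLinearMap.id ℝ H - A with hS
  have hSx : ∀ x, S x = M • x - A x := fun x => by simp [hS]
  have hSin : ∀ x, inner ℝ (S x) x = M * ‖x‖ ^ 2 - inner ℝ (A x) x := fun x => by
    rw [hSx, inner_sub_left, real_inner_smul_left, real_inner_self_eq_norm_sq]
  have hSsymm : ∀ x y, inner ℝ (S x) y = inner ℝ x (S y) := by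
    intro x y
    have := hA.isSymmetric x y
    simp only [ContinuousLinearMap.coe_coe] at this
    rw [hSx, hSx, inner_sub_left, inner_sub_right, real_inner_smul_left, real_inner_smul_right,
      this]
  -- Since `S` is nonnegative, evaluating its form at `x - t S x` bounds `‖S x‖²` by the form at
  -- `x`; the `+ 1` permits `S = 0`. A maximizing sequence therefore consists of approximate
  -- eigenvectors.
  have hSq : ∀ x, ‖S x‖ ^ 2 ≤ (‖S‖ + 1) * inner ℝ (S x) x := by
    intro x
    set t : ℝ := (‖S‖ + 1)⁻¹ with ht
    have ht0 : 0 < t := by positivity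
    have h0 : 0 ≤ inner ℝ (S (x - t • S x)) (x - t • S x) := by
      rw [hSin]; linarith [hAM (x - t • S x)]
    have e : inner ℝ (S (x - t • S x)) (x - t • S x) =
        inner ℝ (S x) x - 2 * t * ‖S x‖ ^ 2 + t ^ 2 * inner ℝ (S (S x)) (S x) := by
      rw [map_sub, map_smul, inner_sub_left, inner_sub_right, inner_sub_right,
        real_inner_smul_left, real_inner_smul_left, real_inner_smul_right, real_inner_smul_right,
        hSsymm (S x) x, real_inner_self_eq_norm_sq]
      ring
    have h2 : inner ℝ (S (S x)) (S x) ≤ ‖S‖ * ‖S x‖ ^ 2 := by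
      calc _ ≤ ‖S (S x)‖ * ‖S x‖ := real_inner_le_norm _ _
        _ ≤ ‖S‖ * ‖S x‖ * ‖S x‖ := mul_le_mul_of_nonneg_right (S.le_opNorm _) (norm_nonneg _)
        _ = _ := by ring
    have h3 : t * ‖S‖ ≤ 1 := by
      rw [ht, inv_mul_le_iff₀ (by positivity)]; linarith [norm_nonneg S]
    have h4 : t * ‖S x‖ ^ 2 ≤ inner ℝ (S x) x := by
      have h5 : t ^ 2 * inner ℝ (S (S x)) (S x) ≤ t * ‖S x‖ ^ 2 := by
        calc t ^ 2 * inner ℝ (S (S x)) (S x) ≤ t ^ 2 * (‖S‖ * ‖S x‖ ^ 2) :=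
              mul_le_mul_of_nonneg_left h2 (sq_nonneg _)
          _ = (t * ‖S x‖ ^ 2) * (t * ‖S‖) := by ring
          _ ≤ (t * ‖S x‖ ^ 2) * 1 := mul_le_mul_of_nonneg_left h3 (by positivity)
          _ = _ := mul_one _
      linarith
    rwa [ht, inv_mul_le_iff₀ (by positivity)] at h4
  obtain ⟨u, -, -, huM, hu⟩ := hM.exists_seq_monotone_tendsto
    (hM.nonempty)
  choose x hx hxu using hu
  have hx1 : ∀ n, ‖x n‖ = 1 := fun n => by simpa using hx n
  have hS0 : Tendsto (fun n => S (x n)) atTop (𝓝 0) := by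
    have h1 : Tendsto (fun n => (‖S‖ + 1) * (M - u n)) atTop (𝓝 0) := by
      simpa using (tendsto_const_nhds (x := M)).sub huM |>.const_mul (‖S‖ + 1)
    have h2 : Tendsto (fun n => ‖S (x n)‖ ^ 2) atTop (𝓝 0) := by
      refine squeeze_zero (fun n => sq_nonneg _) (fun n => ?_) h1
      refine (hSq (x n)).trans (le_of_eq ?_)
      rw [hSin, hx1, ← hxu n]
      ring
    have h3 := h2.sqrt
    simp only [Real.sqrt_sq (norm_nonneg _), Real.sqrt_zero] at h3
    exact tendsto_zero_iff_norm_tendsto_zero.2 h3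
  have hK := hC.isCompact_closure_image_closedBall (f := (C : H →ₗ[ℝ] H)) 1
  obtain ⟨z, -, φ, hφ, hz⟩ := hK.tendsto_subseq (x := fun n => C (x n)) fun n =>
    subset_closure ⟨x n, by simp [hx1], rfl⟩
  -- `L = S + C`, so `L x_n` converges along the subsequence on which `C x_n` does. As `δ < M`, `L`
  -- is bounded below, and `x_n` itself is Cauchy.
  set L : H →L[ℝ] H := M • ContinuousLinearMap.id ℝ H - (A - C) with hL
  have hLx : Tendsto (fun n => L (x (φ n))) atTop (𝓝 z) := by
    have h1 : ∀ n, L (x (φ n)) = S (x (φ n)) + C (x (φ n)) := fun n => by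
      simp only [hL, hS, sub_apply]
      abel
    simp only [h1]
    simpa using (hS0.comp hφ.tendsto_atTop).add hz
  have hLbelow : ∀ x, (M - δ) * ‖x‖ ≤ ‖L x‖ := by
    intro x
    have h1 : ‖M • x‖ ≤ ‖L x‖ + ‖(A - C) x‖ := by
      have : M • x = L x + (A - C) x := by simp [hL]
      rw [this]; exact norm_add_le _ _
    have h2 : ‖(A - C) x‖ ≤ δ * ‖x‖ := ((A - C).le_opNorm x).trans
      (mul_le_mul_of_nonneg_right hδ (norm_nonneg _))
    have h3 : M * ‖x‖ ≤ ‖M • x‖ := by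
      rw [norm_smul]; exact mul_le_mul_of_nonneg_right (Real.le_norm_self _) (norm_nonneg _)
    linarith
  have hcau : CauchySeq fun n => x (φ n) := by
    have hd : 0 < M - δ := by linarith
    rw [Metric.cauchySeq_iff]
    intro e he
    obtain ⟨N, hN⟩ := Metric.cauchySeq_iff.1 hLx.cauchySeq ((M - δ) * e) (by positivity)
    refine ⟨N, fun a ha b hb => ?_⟩
    have h1 := hN a ha b hb
    rw [dist_eq_norm, ← map_sub] at h1
    rw [dist_eq_norm]
    exact lt_of_mul_lt_mul_left ((hLbelow _).trans_lt h1) hd.le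
  obtain ⟨y, hy⟩ := cauchySeq_tendsto_of_complete hcau
  have hy1 : ‖y‖ = 1 := tendsto_nhds_unique hy.norm (by simp [hx1])
  have hSy : S y = 0 := tendsto_nhds_unique ((S.continuous.tendsto y).comp hy)
    (hS0.comp hφ.tendsto_atTop)
  refine Module.End.hasEigenvalue_of_hasEigenvector (x := y)
    (Module.End.hasEigenvector_iff.2 ⟨Module.End.mem_eigenspace_iff.2 ?_, ?_⟩)
  · rw [hSx, sub_eq_zero] at hSy
    exact hSy.symm
  · rw [← norm_ne_zero_iff, hy1]; exact one_ne_zero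

/-- Weyl's inequality for the largest eigenvalue, near a compact operator. -/
theorem abs_topEigenvalue_sub_le {C A : H →L[ℝ] H} (hC : IsCompactOperator C)
    (hA : IsSelfAdjoint A) {l δ : ℝ} (hCl : ∀ x, inner ℝ (C x) x ≤ l * ‖x‖ ^ 2) {v : H}
    (hv : ‖v‖ = 1) (hCv : C v = l • v) (hδ : ‖A - C‖ ≤ δ) (hδl : 2 * δ < l) :
    |topEigenvalue A - l| ≤ δ := by
  have hdiff : ∀ x, ‖x‖ = 1 → |inner ℝ (A x) x - inner ℝ (C x) x| ≤ δ := by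
    intro x hx
    rw [← inner_sub_left, ← sub_apply]
    refine (abs_real_inner_le_norm _ _).trans ?_
    have := (A - C).le_opNorm x
    rw [hx, mul_one] at this
    rw [hx, mul_one]
    exact this.trans hδ
  have hub : l + δ ∈ upperBounds ((fun x => inner ℝ (A x) x) '' Metric.sphere (0 : H) 1) := by
    rintro _ ⟨x, hx, rfl⟩
    have hx1 : ‖x‖ = 1 := by simpa using hx
    have h1 := abs_le.1 (hdiff x hx1)
    have h2 := hCl x
    rw [hx1] at h2
    simp only
    linarith
  have hvm : inner ℝ (A v) v ∈ (fun x => inner ℝ (A x) x) '' Metric.sphere (0 : H) 1 :=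
    ⟨v, by simp [hv], rfl⟩
  have hlub := isLUB_csSup ⟨_, hvm⟩ ⟨_, hub⟩
  have h1 : l - δ ≤ sSup ((fun x => inner ℝ (A x) x) '' Metric.sphere (0 : H) 1) := by
    refine le_trans ?_ (hlub.1 hvm)
    have h1 := abs_le.1 (hdiff v hv)
    rw [hCv, real_inner_smul_left, real_inner_self_eq_norm_sq, hv] at h1
    linarith
  -- The supremum is at least `l - δ > δ`, the margin that attainment requires.
  have h2 := (isGreatest_eigenvalue hC hA hδ (by linarith) hlub).csSup_eq
  rw [topEigenvalue, h2, abs_le]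
  constructor
  · linarith
  · linarith [hlub.2 hub]

end Operators

/-! ### Spectral decompositions -/

section Spectral

variable {H : Type*} [NormedAddCommGroup H] [InnerProductSpace ℝ H]

/-- The remainder lies in the closed span and is orthogonal to every `v p`, hence to itself. -/
theorem Orthonormal.hasSum_inner_smul [CompleteSpace H] {v : ℕ → H} (hv : Orthonormal ℝ v) {x : H}
    (hx : x ∈ (Submodule.span ℝ (range v)).topologicalClosure) :
    HasSum (fun p => inner ℝ (v p) x • v p) x := by
  set K := (Submodule.span ℝ (range v)).topologicalClosure with hK
  have hvK : ∀ p, v p ∈ K := fun p =>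
    Submodule.le_topologicalClosure _ (Submodule.subset_span ⟨p, rfl⟩)
  have hsum : Summable fun p => inner ℝ (v p) x • v p := by
    have h1 := (hv.orthogonalFamily.summable_iff_norm_sq_summable fun p => inner ℝ (v p) x).2
      (hv.inner_products_summable x)
    simpa using h1
  have hs := hsum.hasSum
  set s := ∑' p, inner ℝ (v p) x • v p with hsdef
  have hsK : s ∈ K := (Submodule.isClosed_topologicalClosure _).mem_of_tendsto hs
    (Eventually.of_forall fun F => K.sum_mem fun p _ => K.smul_mem _ (hvK p))
  have horth : ∀ p, inner ℝ (v p) (x - s) = 0 := by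
    intro p
    have h1 := hs.mapL (innerSL ℝ (v p))
    simp only [innerSL_apply_apply, real_inner_smul_right] at h1
    have h2 : HasSum (fun q => inner ℝ (v q) x * inner ℝ (v p) (v q)) (inner ℝ (v p) x) := by
      convert hasSum_ite_eq p (inner ℝ (v p) x) using 2 with q
      rcases eq_or_ne q p with rfl | hqp
      · simp [hv.1 q]
      · rw [hv.2 hqp.symm, mul_zero, if_neg hqp]
    rw [inner_sub_right, h1.unique h2, sub_self]
  have h0 : inner ℝ (x - s) (x - s) = (0 : ℝ) := by
    have hmem : x - s ∈ K := K.sub_mem hx hsK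
    have hcl : IsClosed {y : H | inner ℝ y (x - s) = 0} :=
      isClosed_eq (by fun_prop) continuous_const
    have hsub : (Submodule.span ℝ (range v) : Set H) ⊆ {y : H | inner ℝ y (x - s) = 0} := by
      intro y hy
      induction hy using Submodule.span_induction with
      | mem y hy => obtain ⟨p, rfl⟩ := hy; exact horth p
      | zero => simp
      | add a b _ _ ha hb =>
        simp only [mem_ofPred_eq] at ha hb ⊢
        rw [inner_add_left, ha, hb, add_zero]
      | smul r a _ ha =>
        simp only [mem_ofPred_eq] at ha ⊢
        rw [real_inner_smul_left, ha, mul_zero]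
    exact closure_minimal hsub hcl hmem
  rw [inner_self_eq_zero, sub_eq_zero] at h0
  rwa [← h0] at hs

/-- `C = ∑_p lam_p v_p ⊗ v_p ≠ 0` with nonincreasing `lam` and orthonormal `v`. -/
structure IsSpectralDecomposition (C : H →L[ℝ] H) (lam : ℕ → ℝ) (v : ℕ → H) : Prop where
  ne_zero : C ≠ 0
  antitone : Antitone lam
  orthonormal : Orthonormal ℝ v
  hasSum : HasSum (fun p => lam p • InnerProductSpace.rankOne ℝ (v p) (v p)) C

namespace IsSpectralDecomposition

variable {C : H →L[ℝ] H} {lam : ℕ → ℝ} {v : ℕ → H}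

theorem hasSum_apply (hC : IsSpectralDecomposition C lam v) (x : H) :
    HasSum (fun p => (lam p * inner ℝ (v p) x) • v p) (C x) := by
  have h := hC.hasSum.mapL (ContinuousLinearMap.apply ℝ H x)
  simpa [smul_smul] using h

theorem hasSum_inner (hC : IsSpectralDecomposition C lam v) (x y : H) :
    HasSum (fun p => lam p * inner ℝ (v p) x * inner ℝ (v p) y) (inner ℝ (C x) y) := by
  have h := (hC.hasSum_apply x).mapL (innerSL ℝ y)
  simp only [innerSL_apply_apply, real_inner_smul_right] at h
  rw [real_inner_comm]
  simpa only [real_inner_comm y] using h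

theorem apply_eq_smul (hC : IsSpectralDecomposition C lam v) (p : ℕ) : C (v p) = lam p • v p := by
  refine (hC.hasSum_apply (v p)).unique ?_
  convert hasSum_ite_eq p (lam p • v p) using 2 with q
  rcases eq_or_ne q p with rfl | hqp
  · simp [hC.orthonormal.1 q]
  · rw [hC.orthonormal.2 hqp, mul_zero, if_neg hqp, zero_smul]

theorem apply_eq_zero (hC : IsSpectralDecomposition C lam v) {x : H}
    (hx : ∀ p, inner ℝ (v p) x = 0) : C x = 0 := by
  refine (hC.hasSum_apply x).unique ?_
  simp [hx, hasSum_zero]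

/-- Terms of a convergent series tend to zero, and a nonincreasing sequence stays above its limit.
-/
theorem nonneg (hC : IsSpectralDecomposition C lam v) (p : ℕ) : 0 ≤ lam p := by
  have h1 := hC.hasSum.summable.tendsto_atTop_zero.norm
  have h2 : Tendsto lam atTop (𝓝 0) := by
    refine tendsto_zero_iff_norm_tendsto_zero.2 ?_
    simpa [norm_smul, hC.orthonormal.1] using h1
  exact hC.antitone.le_of_tendsto h2 p

theorem pos (hC : IsSpectralDecomposition C lam v) : 0 < lam 0 := by
  refine (hC.nonneg 0).lt_of_ne fun h0 => hC.ne_zero ?_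
  have h1 : ∀ p, lam p = 0 := fun p =>
    le_antisymm (h0 ▸ hC.antitone (Nat.zero_le p)) (hC.nonneg p)
  refine hC.hasSum.unique ?_
  simp [h1, hasSum_zero]

theorem inner_comm (hC : IsSpectralDecomposition C lam v) (x y : H) :
    inner ℝ (C x) y = inner ℝ x (C y) := by
  rw [real_inner_comm (C y) x]
  refine (hC.hasSum_inner x y).unique ?_
  simpa only [mul_right_comm] using hC.hasSum_inner y x

theorem inner_nonneg (hC : IsSpectralDecomposition C lam v) (x : H) : 0 ≤ inner ℝ (C x) x :=
  (hC.hasSum_inner x x).nonneg fun p => by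
    rw [mul_assoc]
    exact mul_nonneg (hC.nonneg p) (mul_self_nonneg _)

theorem inner_le (hC : IsSpectralDecomposition C lam v) (x : H) :
    inner ℝ (C x) x ≤ lam 0 * ‖x‖ ^ 2 := by
  have hs := (hC.orthonormal.inner_products_summable x).hasSum.mul_left (lam 0)
  refine (hasSum_le (fun p => ?_) (hC.hasSum_inner x x) hs).trans
    (mul_le_mul_of_nonneg_left (hC.orthonormal.tsum_inner_products_le x) (hC.nonneg 0))
  rw [mul_assoc, ← pow_two, Real.norm_eq_abs, sq_abs]
  exact mul_le_mul_of_nonneg_right (hC.antitone (Nat.zero_le p)) (sq_nonneg _)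

variable [CompleteSpace H]

theorem isSelfAdjoint (hC : IsSpectralDecomposition C lam v) : IsSelfAdjoint C :=
  ContinuousLinearMap.isSelfAdjoint_iff_isSymmetric.2 hC.inner_comm

/-- A norm limit of finite-rank operators. -/
theorem isCompactOperator (hC : IsSpectralDecomposition C lam v) : IsCompactOperator C := by
  refine isCompactOperator_of_tendsto hC.hasSum (Eventually.of_forall fun s => ?_)
  induction s using Finset.induction_on with
  | empty => simpa using isCompactOperator_zero
  | insert p s hp ih =>
    rw [Finset.sum_insert hp]
    refine IsCompactOperator.add ?_ ih
    have h1 : IsCompactOperator (innerSL ℝ (v p)) :=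
      isCompactOperator_of_locallyCompactSpace_dom (innerSL ℝ (v p))
    exact (h1.clm_comp (ContinuousLinearMap.toSpanSingleton ℝ (v p))).smul (lam p)

theorem abs_topEigenvalue_sub_le (hC : IsSpectralDecomposition C lam v) {A : H →L[ℝ] H}
    (hA : IsSelfAdjoint A) {δ : ℝ} (hδ : ‖A - C‖ ≤ δ) (hδl : 2 * δ < lam 0) :
    |topEigenvalue A - lam 0| ≤ δ :=
  _root_.abs_topEigenvalue_sub_le hC.isCompactOperator hA hC.inner_le (hC.orthonormal.1 0)
    (hC.apply_eq_smul 0) hδ hδl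

/-- The operator `(C + lam_0 Id)^{-1/2}`. -/
theorem isInvSqrt (hC : IsSpectralDecomposition C lam v) :
    IsInvSqrt (C + lam 0 • ContinuousLinearMap.id ℝ H)
      (invSqrt (C + lam 0 • ContinuousLinearMap.id ℝ H)) := by
  refine isInvSqrt_invSqrt (exists_isInvSqrt ?_ hC.pos fun x => ?_)
  · exact hC.isSelfAdjoint.add (IsSelfAdjoint.smul (by simp [IsSelfAdjoint]) (IsSelfAdjoint.one _))
  · simpa [inner_add_left, real_inner_smul_left] using hC.inner_nonneg x

/-- As `C ≥ 0` and the top eigenvalue is at least `lam 0 - δ`, the shifted estimate is bounded below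
by `lam 0 - 2δ ≥ lam 0 / 2`. The shifted operators differ by at most `2δ`: one `δ` from `A`, one
from the eigenvalue. -/
theorem abs_norm_invSqrt_sub_le (hC : IsSpectralDecomposition C lam v) {A : H →L[ℝ] H}
    (hA : IsSelfAdjoint A) {δ : ℝ} (hδ : ‖A - C‖ ≤ δ) (hδl : 4 * δ ≤ lam 0) (w : H) :
    |‖invSqrt (A + topEigenvalue A • ContinuousLinearMap.id ℝ H) w‖ -
      ‖invSqrt (C + lam 0 • ContinuousLinearMap.id ℝ H) w‖| ≤ √(2 * δ) / (lam 0 / 2) * ‖w‖ := by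
  have hpos := hC.pos
  have hδ0 : 0 ≤ δ := (norm_nonneg _).trans hδ
  have htop := hC.abs_topEigenvalue_sub_le hA hδ (by linarith)
  have htop' := abs_le.1 htop
  have hA' : ∀ x, lam 0 / 2 * ‖x‖ ^ 2 ≤
      inner ℝ ((A + topEigenvalue A • ContinuousLinearMap.id ℝ H) x) x := by
    intro x
    have e : inner ℝ ((A + topEigenvalue A • ContinuousLinearMap.id ℝ H) x) x =
        inner ℝ (C x) x + inner ℝ ((A - C) x) x + topEigenvalue A * ‖x‖ ^ 2 := by
      simp [inner_add_left, inner_sub_left, real_inner_smul_left]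
    have h1 : |inner ℝ ((A - C) x) x| ≤ δ * ‖x‖ ^ 2 := by
      calc _ ≤ ‖(A - C) x‖ * ‖x‖ := abs_real_inner_le_norm _ _
        _ ≤ δ * ‖x‖ * ‖x‖ := mul_le_mul_of_nonneg_right (((A - C).le_opNorm x).trans
            (mul_le_mul_of_nonneg_right hδ (norm_nonneg _))) (norm_nonneg _)
        _ = _ := by ring
    have h2 : (lam 0 - δ) * ‖x‖ ^ 2 ≤ topEigenvalue A * ‖x‖ ^ 2 :=
      mul_le_mul_of_nonneg_right (by linarith) (sq_nonneg _)
    have h3 : 4 * δ * ‖x‖ ^ 2 ≤ lam 0 * ‖x‖ ^ 2 := mul_le_mul_of_nonneg_right hδl (sq_nonneg _)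
    rw [e]
    linarith [hC.inner_nonneg x, (abs_le.1 h1).1]
  have hC' : ∀ x, lam 0 / 2 * ‖x‖ ^ 2 ≤
      inner ℝ ((C + lam 0 • ContinuousLinearMap.id ℝ H) x) x := by
    intro x
    have h1 := hC.inner_nonneg x
    have h2 : 0 ≤ lam 0 * ‖x‖ ^ 2 := by positivity
    have e : inner ℝ ((C + lam 0 • ContinuousLinearMap.id ℝ H) x) x =
        inner ℝ (C x) x + lam 0 * ‖x‖ ^ 2 := by
      simp [inner_add_left, real_inner_smul_left]
    rw [e]
    linarith
  have hAs : IsSelfAdjoint (A + topEigenvalue A • ContinuousLinearMap.id ℝ H) :=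
    hA.add (IsSelfAdjoint.smul (by simp [IsSelfAdjoint]) (IsSelfAdjoint.one _))
  have hinv := isInvSqrt_invSqrt (exists_isInvSqrt hAs (half_pos hpos) hA')
  refine (hinv.abs_norm_sub_norm_le hC.isInvSqrt (half_pos hpos) hA' hC' w).trans ?_
  gcongr
  have e : A + topEigenvalue A • ContinuousLinearMap.id ℝ H -
      (C + lam 0 • ContinuousLinearMap.id ℝ H) =
      (A - C) + (topEigenvalue A - lam 0) • ContinuousLinearMap.id ℝ H := by
    rw [sub_smul]; abel
  rw [e]
  have h1 : ‖(topEigenvalue A - lam 0) • ContinuousLinearMap.id ℝ H‖ ≤ δ := by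
    rw [norm_smul, Real.norm_eq_abs]
    exact (mul_le_mul htop ContinuousLinearMap.norm_id_le (norm_nonneg _) hδ0).trans
      (by rw [mul_one])
  linarith [norm_add_le (A - C) ((topEigenvalue A - lam 0) • ContinuousLinearMap.id ℝ H)]

/-- With `y = (C + lam 0)⁻¹ x`, expand `⟨y, x⟩` in the `v p`; the eigenvector equation gives `⟨y, v
p⟩ = ⟨v p, x⟩ / (lam 0 + lam p)`. -/
theorem hasSum_norm_invSqrt_sq (hC : IsSpectralDecomposition C lam v) {x : H}
    (hx : x ∈ (Submodule.span ℝ (range v)).topologicalClosure) :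
    HasSum (fun p => (lam 0 + lam p)⁻¹ * inner ℝ (v p) x ^ 2)
      (‖invSqrt (C + lam 0 • ContinuousLinearMap.id ℝ H) x‖ ^ 2) := by
  obtain ⟨y, hy, hRy⟩ := hC.isInvSqrt.exists_inner_eq x
  rw [hRy]
  have h := (hC.orthonormal.hasSum_inner_smul hx).mapL (innerSL ℝ y)
  simp only [innerSL_apply_apply, real_inner_smul_right] at h
  have key : ∀ p, (lam 0 + lam p)⁻¹ * inner ℝ (v p) x ^ 2 =
      inner ℝ (v p) x * inner ℝ y (v p) := by
    intro p
    have hp : 0 < lam 0 + lam p := add_pos_of_pos_of_nonneg hC.pos (hC.nonneg p)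
    have e : inner ℝ (v p) x = (lam 0 + lam p) * inner ℝ y (v p) := by
      rw [← hy]
      simp only [add_apply, smul_apply, ContinuousLinearMap.id_apply, inner_add_right,
        real_inner_smul_right]
      rw [← hC.inner_comm, hC.apply_eq_smul, real_inner_smul_left, real_inner_comm]
      ring
    rw [e]
    field_simp
  simpa only [key] using h

theorem hasSum_norm_sq (hC : IsSpectralDecomposition C lam v) {x : H}
    (hx : x ∈ (Submodule.span ℝ (range v)).topologicalClosure) :
    HasSum (fun p => 1 * inner ℝ (v p) x ^ 2) (‖ContinuousLinearMap.id ℝ H x‖ ^ 2) := by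
  have h := (hC.orthonormal.hasSum_inner_smul hx).mapL (innerSL ℝ x)
  simp only [innerSL_apply_apply, real_inner_smul_right, real_inner_self_eq_norm_sq] at h
  simpa [pow_two, real_inner_comm x] using h

end IsSpectralDecomposition

end Spectral

/-! ### The limit theorems -/

section Limit

variable {H : Type*} [NormedAddCommGroup H] [InnerProductSpace ℝ H] [CompleteSpace H]
  [SecondCountableTopology H] [MeasurableSpace H] [BorelSpace H]
  {Ω Ω₁ Ω₂ : Type*} [MeasurableSpace Ω] [MeasurableSpace Ω₁] [MeasurableSpace Ω₂]
  {P : Measure Ω} [IsProbabilityMeasure P] {P₁ : Measure Ω₁} [IsProbabilityMeasure P₁]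
  {P₂ : Measure Ω₂} [IsProbabilityMeasure P₂]
  {C : H →L[ℝ] H} {lam : ℕ → ℝ} {v : ℕ → H} {W : Ω₁ → CadlagPath H}
  {B : ℕ → unitInterval → Ω₂ → ℝ}


/-- The bridge scores of a Hilbert space Brownian motion with covariance operator
`∑_p lam_p v_p ⊗ v_p` have the law of the scaled independent Brownian bridges `√lam_p B_p`. -/
theorem IsHilbertBrownianMotion.identDistrib_bridgeScore (hW : IsHilbertBrownianMotion C W P₁)
    (hC : IsSpectralDecomposition C lam v) (hB : ∀ p, IsBrownianBridge (B p) P₂)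
    (hind : iIndepFun (fun p ω t => B p t ω) P₂) :
    IdentDistrib (fun ω => bridgeScore v (W ω)) (fun ω (q : ℕ × ℚ) =>
      √(lam q.1) * B q.1 (projIcc (0 : ℝ) 1 zero_le_one (q.2 : ℝ)) ω) P₁ P₂ := by
  have h1 := hW.isGaussianProcess_bridgeScore v
  have h2 := isGaussianProcess_smul_brownianBridge hB hind fun p => √(lam p)
  refine ⟨aemeasurable_pi_lambda _ fun q => h1.aemeasurable q,
    aemeasurable_pi_lambda _ fun q => h2.aemeasurable q,
    h1.map_eq_of_covariance_eq h2 (fun q => ?_) fun q q' => ?_⟩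
  · rw [hW.integral_bridgeScore, integral_const_mul, (hB q.1).centered, mul_zero]
  · rw [hW.covariance_bridgeScore (fun x => by rw [← hC.inner_comm]; exact hC.inner_nonneg x)
      (fun x y => by rw [← hC.inner_comm, real_inner_comm]),
      covariance_smul_brownianBridge hB hind (fun p => √(lam p)), hC.apply_eq_smul,
      real_inner_smul_right]
    split_ifs with hp
    · rw [← hp, real_inner_self_eq_norm_sq, hC.orthonormal.1, Real.sq_sqrt (hC.nonneg _)]
      ring
    · rw [hC.orthonormal.2 hp, mul_zero, mul_zero]

/-- The limit theorem for the statistics `max_k ‖R (weightedSum h n k X)‖`, where `R` is an operator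
whose squared norm is the quadratic form `∑_p c_p ⟨v_p, x⟩²`. -/
theorem tendstoInDistribution_iSup_norm_weightedSum (hC : IsSpectralDecomposition C lam v)
    (hW : IsHilbertBrownianMotion C W P₁) {ε : ℤ → Ω → H}
    (hFCLT : TendstoInDistribution (fun (n : ℕ) ω => partialSumPath (fun i => ε i ω) n)
      atTop W (fun _ => P) P₁) {h : ℝ → ℝ} (hh : IsChangeWeight h)
    {m : ℕ → H} {X : ℕ → Ω → H} (hX : ∀ i, 1 ≤ i → ∀ ω, X i ω = m i + ε i ω)
    (hm : ∀ i, 1 ≤ i → m i = m 1) (hXm : ∀ i, 1 ≤ i → Measurable (X i))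
    (hB : ∀ p, IsBrownianBridge (B p) P₂) (hind : iIndepFun (fun p ω t => B p t ω) P₂)
    {R : H →L[ℝ] H} {c : ℕ → ℝ} (hc : ∀ p, 0 ≤ c p)
    (hR : ∀ x ∈ (Submodule.span ℝ (range v)).topologicalClosure,
      HasSum (fun p => c p * inner ℝ (v p) x ^ 2) (‖R x‖ ^ 2)) :
    (∀ᵐ ω ∂P₂, SupWeightedFinite (fun p => c p * lam p)
      fun p => gradualIntegral hh.boundedVariation fun s => B p s ω) ∧
    TendstoInDistribution
      (fun (n : ℕ) ω => ⨆ k : Finset.Ico 1 n, ‖R (weightedSum h n k fun i => X i ω)‖) atTop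
      (fun ω => supWeighted (fun p => c p * lam p)
        fun p => gradualIntegral hh.boundedVariation fun s => B p s ω) (fun _ => P) P₂ := by
  have hid : IdentDistrib (fun ω => rationalSup h c (bridgeScore v (W ω)))
      (fun ω => rationalSup h c fun q : ℕ × ℚ =>
        √(lam q.1) * B q.1 (projIcc (0 : ℝ) 1 zero_le_one (q.2 : ℝ)) ω) P₁ P₂ :=
    (hW.identDistrib_bridgeScore hC hB hind).comp (measurable_rationalSup h c)
  have hK := Submodule.isClosed_topologicalClosure (Submodule.span ℝ (range v))
  have hWK := hW.ae_mem hK fun x hx => hC.apply_eq_zero fun p =>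
    (Submodule.mem_orthogonal _ x).1 hx _
      (Submodule.le_topologicalClosure _ (Submodule.subset_span ⟨p, rfl⟩))
  have hsup : ∀ᵐ ω ∂P₁, rationalSup h c (bridgeScore v (W ω)) ≠ ⊤ ∧
      √(rationalSup h c (bridgeScore v (W ω))).toReal =
        ⨆ t : Ioo (0 : ℝ) 1, ‖R (bridgeIntegral hh (W ω) t)‖ := by
    filter_upwards [hWK, hW.cont] with ω hω hcont
    exact rationalSup_bridgeScore hh hc hK hR hcont hω
  have hbridge : ∀ᵐ ω ∂P₂, rationalSup h c (fun q : ℕ × ℚ =>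
      √(lam q.1) * B q.1 (projIcc (0 : ℝ) 1 zero_le_one (q.2 : ℝ)) ω) =
      esupWeighted (fun p => c p * lam p)
        fun p => gradualIntegral hh.boundedVariation fun s => B p s ω := by
    filter_upwards [ae_all_iff.2 fun p => (hB p).cont, ae_all_iff.2 fun p => (hB p).ae_zero]
      with ω hcont hzero
    exact rationalSup_sqrt_mul_eq hh hc hC.nonneg (b := fun p s => B p s ω) hcont hzero
  -- Finiteness is known for the paths of `W` and passes to the bridges by equality in law.
  have hfin : ∀ᵐ ω ∂P₂, rationalSup h c (fun q : ℕ × ℚ =>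
      √(lam q.1) * B q.1 (projIcc (0 : ℝ) 1 zero_le_one (q.2 : ℝ)) ω) ≠ ⊤ :=
    hid.ae_snd (p := fun r => r ≠ ⊤) (measurableSet_singleton _).compl
      (hsup.mono fun _ h => h.1)
  have hlim : ∀ᵐ ω ∂P₂, SupWeightedFinite (fun p => c p * lam p)
        (fun p => gradualIntegral hh.boundedVariation fun s => B p s ω) ∧
      supWeighted (fun p => c p * lam p)
        (fun p => gradualIntegral hh.boundedVariation fun s => B p s ω) =
      √(rationalSup h c (fun q : ℕ × ℚ =>
        √(lam q.1) * B q.1 (projIcc (0 : ℝ) 1 zero_le_one (q.2 : ℝ)) ω)).toReal := by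
    filter_upwards [hbridge, hfin] with ω hω hω'
    rw [hω] at hω' ⊢
    exact supWeighted_of_esupWeighted_ne_top (fun p => mul_nonneg (hc p) (hC.nonneg p)) hω'
  refine ⟨hlim.mono fun _ h => h.1, ?_⟩
  have hstat : ∀ (n : ℕ) ω, ⨆ k : Finset.Ico 1 n, ‖R (weightedSum h n k fun i => X i ω)‖ =
      maxStat h R n (partialSumPath (fun i => ε i ω) n) := fun n ω =>
    iSup_norm_weightedSum_eq hh R (fun i => ε i ω) (fun i hi => hX i hi ω) hm n
  have hidT := hid.comp (u := fun r : ℝ≥0∞ => √r.toReal) (by fun_prop)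
  -- The limit first appears on `Ω₁` as a function of `W`; a variable on `Ω₂` with the same law then
  -- replaces it.
  have hcmt := tendstoInDistribution_of_tendsto_prod hFCLT (Φ := maxStat h R)
    (Z := fun ω => √(rationalSup h c (bridgeScore v (W ω))).toReal) ?_ (fun n => ?_)
    hidT.aemeasurable_fst
  · simp only [hstat]
    refine TendstoInDistribution.congr (fun _ => EventuallyEq.rfl)
      (hlim.mono fun _ h => h.2.symm) ?_
    refine ⟨hcmt.forall_aemeasurable, hidT.aemeasurable_snd, ?_⟩
    convert! hcmt.tendsto using 2
    refine congrArg 𝓝 (Subtype.ext ?_)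
    exact hidT.map_eq.symm
  · filter_upwards [hsup, hW.cont] with ω hω hcont
    rw [hω.2]
    exact tendsto_maxStat hh R hcont
  · simp only [← hstat]
    exact (measurable_iSup_norm_weightedSum h R hXm n).aemeasurable

end Limit

/-! ### Random perturbations of a statistic -/

section Slutsky

variable {Ω Ω' : Type*} [MeasurableSpace Ω] [MeasurableSpace Ω'] {P : Measure Ω}
  [IsProbabilityMeasure P] {P' : Measure Ω'} [IsProbabilityMeasure P']

/-- Real random variables that converge in distribution are tight from above. -/
theorem MeasureTheory.TendstoInDistribution.exists_eventually_measure_le {S : ℕ → Ω → ℝ}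
    {Z : Ω' → ℝ}
    (h : TendstoInDistribution S atTop Z (fun _ => P) P') {e : ℝ≥0∞} (he : 0 < e) :
    ∃ M : ℝ, 0 < M ∧ ∀ᶠ n in atTop, P {ω | M ≤ S n ω} ≤ e := by
  have := Measure.isProbabilityMeasure_map h.aemeasurable_limit
  have h1 : Tendsto (fun k : ℕ => P'.map Z (Ici (k : ℝ))) atTop (𝓝 0) := by
    have h2 := tendsto_measure_iInter_atTop (μ := P'.map Z) (s := fun k : ℕ => Ici (k : ℝ))
      (fun k => measurableSet_Ici.nullMeasurableSet)
      (fun k l hkl => Ici_subset_Ici.2 (Nat.cast_le.2 hkl)) ⟨0, measure_ne_top _ _⟩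
    have h3 : ⋂ k : ℕ, Ici (k : ℝ) = ∅ := by
      refine eq_empty_of_forall_notMem fun x hx => ?_
      obtain ⟨k, hk⟩ := exists_nat_gt x
      exact absurd (mem_iInter.1 hx k) (not_le.2 hk)
    rwa [h3, measure_empty] at h2
  obtain ⟨k, hk, hk0⟩ := ((h1.eventually (gt_mem_nhds he)).and (eventually_gt_atTop 0)).exists
  refine ⟨k, Nat.cast_pos.2 hk0, ?_⟩
  have h4 := ProbabilityMeasure.limsup_measure_closed_le_of_tendsto h.tendsto
    (isClosed_Ici (a := (k : ℝ)))
  simp only [ProbabilityMeasure.coe_mk] at h4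
  filter_upwards [eventually_lt_of_limsup_lt (h4.trans_lt hk)] with n hn
  rw [Measure.map_apply_of_aemeasurable (h.forall_aemeasurable n) measurableSet_Ici] at hn
  exact hn.le

/-- If `|V n - U n| ≤ g δ * S n` whenever `‖A n - C‖ ≤ δ`, where `g δ → 0` as `δ → 0`, `S n`
converges in distribution and `A n → C` in probability, then `V n - U n → 0` in probability. -/
theorem MeasureTheory.TendstoInMeasure.sub_of_norm_sub_le {F : Type*} [NormedAddCommGroup F]
    {A : ℕ → Ω → F} {C : F} (hA : TendstoInMeasure P A atTop fun _ => C) {S : ℕ → Ω → ℝ}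
    {Z : Ω' → ℝ}
    (hS : TendstoInDistribution S atTop Z (fun _ => P) P') {U V : ℕ → Ω → ℝ} {g : ℝ → ℝ}
    {l : ℝ} (hl : 0 < l) (hg : Tendsto g (𝓝[>] 0) (𝓝 0)) (hg0 : ∀ δ, 0 ≤ g δ)
    (hUV : ∀ n ω δ, ‖A n ω - C‖ ≤ δ → δ ≤ l → |V n ω - U n ω| ≤ g δ * S n ω) :
    TendstoInMeasure P (V - U) atTop 0 := by
  rw [tendstoInMeasure_iff_norm] at hA ⊢
  intro r hr
  rw [ENNReal.tendsto_nhds_zero]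
  intro e he
  obtain ⟨M, hM, hSM⟩ := hS.exists_eventually_measure_le (ENNReal.half_pos he.ne')
  -- Here `g δ * M < r`, so a deviation of size `r` needs `S n ≥ M` or an operator error of at least
  -- `δ`.
  obtain ⟨δ, ⟨hδg, hδl⟩, hδ0⟩ := ((hg.eventually (gt_mem_nhds (div_pos hr hM))).and
    (mem_nhdsWithin_of_mem_nhds (Iic_mem_nhds hl)) |>.and self_mem_nhdsWithin).exists
  have h1 := ENNReal.tendsto_nhds_zero.1 (hA δ hδ0) (e / 2) (ENNReal.half_pos he.ne')
  filter_upwards [hSM, h1] with n hn1 hn2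
  calc P {ω | r ≤ ‖(V - U) n ω - (0 : ℕ → Ω → ℝ) n ω‖}
      ≤ P ({ω | δ ≤ ‖A n ω - C‖} ∪ {ω | M ≤ S n ω}) := by
        refine measure_mono fun ω hω => ?_
        by_contra hcon
        simp only [mem_union, mem_ofPred_eq, not_or, not_le] at hcon
        simp only [mem_ofPred_eq, Pi.sub_apply, Pi.zero_apply, sub_zero, Real.norm_eq_abs] at hω
        have h2 := hUV n ω δ hcon.1.le hδl
        rw [lt_div_iff₀ hM] at hδg
        have h3 := mul_le_mul_of_nonneg_left hcon.2.le (hg0 δ)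
        linarith
    _ ≤ e / 2 + e / 2 := (measure_union_le _ _).trans (add_le_add hn2 hn1)
    _ = e := ENNReal.add_halves e

/-- Nonnegativity covers an empty index set, where real suprema are `0`; this occurs for `n ≤ 1`. -/
theorem abs_iSup_sub_iSup_le {ι : Type*} [Finite ι] {a b s : ι → ℝ} {r : ℝ} (hr : 0 ≤ r)
    (ha : ∀ i, 0 ≤ a i) (hb : ∀ i, 0 ≤ b i) (hs : ∀ i, 0 ≤ s i)
    (h : ∀ i, |a i - b i| ≤ r * s i) : |(⨆ i, a i) - ⨆ i, b i| ≤ r * ⨆ i, s i := by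
  have key : ∀ {a b : ι → ℝ}, (∀ i, 0 ≤ b i) → (∀ i, |a i - b i| ≤ r * s i) →
      ⨆ i, a i ≤ (⨆ i, b i) + r * ⨆ i, s i := by
    intro a b hb h
    refine Real.iSup_le (fun i => ?_)
      (add_nonneg (Real.iSup_nonneg hb) (mul_nonneg hr (Real.iSup_nonneg hs)))
    have h1 := (abs_le.1 (h i)).2
    have h2 := le_ciSup (finite_range b).bddAbove i
    have h3 := mul_le_mul_of_nonneg_left (le_ciSup (finite_range s).bddAbove i) hr
    linarith
  rw [abs_le]
  constructor
  · linarith [key ha fun i => by rw [abs_sub_comm]; exact h i]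
  · linarith [key hb h]

end Slutsky

/-! ### Main theorem -/

theorem mainTheorem3
    {H : Type*} [NormedAddCommGroup H] [InnerProductSpace ℝ H] [CompleteSpace H]
    [SecondCountableTopology H] [MeasurableSpace H] [BorelSpace H]
    {Ω : Type*} [MeasurableSpace Ω] (P : Measure Ω) [IsProbabilityMeasure P]
    -- the errors and their long-run covariance operator
    (ε : ℤ → Ω → H) (lam : ℕ → ℝ) (v : ℕ → H) (hε : ErrorAssumption ε P lam v)
    -- the functional central limit theorem in the Skorokhod space
    {Ω₁ : Type*} [MeasurableSpace Ω₁] (P₁ : Measure Ω₁) [IsProbabilityMeasure P₁]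
    (W : Ω₁ → CadlagPath H) (hW : IsHilbertBrownianMotion (longRunCov ε P) W P₁)
    (hFCLT : TendstoInDistribution (fun (n : ℕ) ω => partialSumPath (fun i => ε i ω) n)
      atTop W (fun _ => P) P₁)
    -- the weight function
    (h : ℝ → ℝ) (hh : IsChangeWeight h)
    -- the observations, under the null hypothesis
    (m : ℕ → H) (X : ℕ → Ω → H) (hX : ∀ i, 1 ≤ i → ∀ ω, X i ω = m i + ε i ω)
    (hH₀ : ∀ i, 1 ≤ i → m i = m 1)
    -- i.i.d. Brownian bridges
    {Ω₂ : Type*} [MeasurableSpace Ω₂] (P₂ : Measure Ω₂) [IsProbabilityMeasure P₂]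
    (B : ℕ → unitInterval → Ω₂ → ℝ) (hB : ∀ p, IsBrownianBridge (B p) P₂)
    (hBindep : iIndepFun (fun p ω t => B p t ω) P₂)
    (G : ℕ → ℝ → Ω₂ → ℝ)
    (hG : ∀ p t ω, G p t ω = gradualIntegral hh.boundedVariation (fun s => B p s ω) t) :
    ((∀ᵐ ω ∂P₂, SupWeightedFinite lam (fun p t => G p t ω)) ∧
      TendstoInDistribution (fun (n : ℕ) ω => statFF h n (fun i => X i ω)) atTop
        (fun ω => supWeighted lam (fun p t => G p t ω)) (fun _ => P) P₂) ∧
    ∀ Chat : ℕ → Ω → H →L[ℝ] H,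
      (∀ n ω, IsSelfAdjoint (Chat n ω)) →
      TendstoInMeasure P Chat atTop (fun _ => longRunCov ε P) →
      (∀ n, AEMeasurable (fun ω => statWF h n (Chat n ω) (fun i => X i ω)) P) →
      (∀ᵐ ω ∂P₂, SupWeightedFinite (fun p => lam p / (lam 0 + lam p)) (fun p t => G p t ω)) ∧
        TendstoInDistribution (fun (n : ℕ) ω => statWF h n (Chat n ω) (fun i => X i ω)) atTop
          (fun ω => supWeighted (fun p => lam p / (lam 0 + lam p)) (fun p t => G p t ω))
          (fun _ => P) P₂ := by
  have hC : IsSpectralDecomposition (longRunCov ε P) lam v :=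
    ⟨hε.longRunCov_ne_zero, hε.antitone, hε.orthonormal, hε.spectral⟩
  have hXm : ∀ i, 1 ≤ i → Measurable (X i) := fun i hi => by
    rw [show X i = fun ω => m i + ε i ω from funext (hX i hi)]
    exact (hε.measurable i).const_add _
  have hGeq : ∀ ω, (fun p t => G p t ω) =
      fun p => gradualIntegral hh.boundedVariation fun s => B p s ω := fun ω =>
    funext fun p => funext fun t => hG p t ω
  simp only [hGeq]
  -- The case `R = Id` and `c = 1`.
  have hFF := tendstoInDistribution_iSup_norm_weightedSum hC hW hFCLT hh hX hH₀ hXm hB hBindep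
    (c := fun _ => 1) (fun _ => zero_le_one) fun x hx => hC.hasSum_norm_sq hx
  simp only [one_mul] at hFF
  refine ⟨hFF, fun Chat hsa hChat hmeas => ?_⟩
  have hWF := tendstoInDistribution_iSup_norm_weightedSum hC hW hFCLT hh hX hH₀ hXm hB hBindep
    (c := fun p => (lam 0 + lam p)⁻¹)
    (fun p => inv_nonneg.2 (add_nonneg (hC.nonneg 0) (hC.nonneg p)))
    fun x hx => hC.hasSum_norm_invSqrt_sq hx
  simp only [← div_eq_inv_mul] at hWF
  refine ⟨hWF.1, tendstoInDistribution_of_tendstoInMeasure_sub _ _ hWF.2 ?_ hmeas⟩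
  -- The tight factor is the statistic of part (a), since the perturbation bound is proportional to
  -- `‖w‖`.
  refine TendstoInMeasure.sub_of_norm_sub_le hChat hFF.2
    (g := fun δ => √(2 * δ) / (lam 0 / 2)) (l := lam 0 / 4) (div_pos hC.pos four_pos) ?_
    (fun δ => div_nonneg (Real.sqrt_nonneg _) (half_pos hC.pos).le) fun n ω δ hδ hδl => ?_
  · have : Continuous fun δ : ℝ => √(2 * δ) / (lam 0 / 2) := by fun_prop
    simpa using (this.tendsto 0).mono_left nhdsWithin_le_nhds
  · exact abs_iSup_sub_iSup_le (div_nonneg (Real.sqrt_nonneg _) (half_pos hC.pos).le)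
      (fun _ => norm_nonneg _) (fun _ => norm_nonneg _) (fun _ => norm_nonneg _)
      fun k => hC.abs_norm_invSqrt_sub_le (hsa n ω) hδ (by linarith) _
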